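/- Let $\mathcal{G}$ be a second-countable, locally compact, Hausdorff topological groupoid with unit space $\mathcal{G}^{(0)}$, range map $r$ and source map $s$, which has a (left) Haar system. For $u\in\mathcal{G}^{(0)}$ let $A_u=\{\gamma\in\mathcal{G}: r(\gamma)=s(\gamma)=u\}$ be the isotropy group at $u$, and let $\mathcal{A}=\{\gamma\in\mathcal{G}: r(\gamma)=s(\gamma)\}$ be the isotropy groupoid. Assume that every $A_u$ is abelian and that the isotropy groups vary continuously, that is, the map $u\mapsto A_u$ from $\mathcal{G}^{(0)}$ to the space of closed subsets of $\mathcal{G}$ is continuous in the Fell topology. Then $\mathcal{A}$ has a Haar system, and for every Haar system $\beta=\{\beta^u\}$ on $\mathcal{A}$ the following holds. Let $\hat{\mathcal{A}}$ be the spectrum of the commutative $C^*$-algebra $C^*(\mathcal{A},\beta)$, that is, $$\hat{\mathcal{A}}=\{(\chi,u): u\in\mathcal{G}^{(0)},\ \chi\in\hat A_u\},$$ where $\hat A_u$ is the set of continuous characters $A_u\to\mathbb{T}$ and $(\chi,u)$ is regarded as the functional $f\mapsto\int_{A_u}\chi(a)f(a)\,d\beta^u(a)$ on $C_c(\mathcal{A})$,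 with the topology of pointwise convergence on $C_c(\mathcal{A})$ (the weak-$*$ topology). Let $\mathcal{R}=\mathcal{G}/\mathcal{A}$, with elements $\dot\gamma$, act on the right of $\hat{\mathcal{A}}$ by $(\chi,u)\cdot\dot\gamma=(\chi\cdot\gamma,s(\gamma))$ for $r(\gamma)=u$, where $(\chi\cdot\gamma)(a)=\chi(\gamma a\gamma^{-1})$ for $a\in A_{s(\gamma)}$. Then the orbit space $\mathcal{G}^{(0)}/\mathcal{G}$ is $T_1$ if and only if the orbit space $\hat{\mathcal{A}}/\mathcal{R}$ is $T_1$ (both with the quotient topology). -/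

import Mathlib

open MeasureTheory Topology

/-- A topological groupoid with space of arrows `G` and unit space `X`. An arrow `γ` goes from its
source `s γ` to its range `r γ`, and the product `γη` is defined when `s γ = r η`. Since `r` and
`unit` are continuous with `r ∘ unit = id`, the map `unit` is a homeomorphism of `X` onto the
subspace of units of `G`. -/
structure TopologicalGroupoid (G X : Type*) [TopologicalSpace G] [TopologicalSpace X] where
  r : G → X
  s : G → X
  unit : X → G
  inv : G → G
  mul : (γ η : G) → s γ = r η → G
  r_unit : ∀ u, r (unit u) = u
  s_unit : ∀ u, s (unit u) = u
  r_inv : ∀ γ, r (inv γ) = s γ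
  s_inv : ∀ γ, s (inv γ) = r γ
  r_mul : ∀ γ η h, r (mul γ η h) = r γ
  s_mul : ∀ γ η h, s (mul γ η h) = s η
  mul_assoc : ∀ (γ η ζ : G) (h₁ : s γ = r η) (h₂ : s η = r ζ),
    mul (mul γ η h₁) ζ ((s_mul γ η h₁).trans h₂) = mul γ (mul η ζ h₂) (h₁.trans (r_mul η ζ h₂).symm)
  unit_mul : ∀ u γ h, mul (unit u) γ h = γ
  mul_unit : ∀ γ u h, mul γ (unit u) h = γ
  mul_inv : ∀ γ, mul γ (inv γ) (r_inv γ).symm = unit (r γ)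
  inv_mul : ∀ γ, mul (inv γ) γ (s_inv γ) = unit (s γ)
  continuous_r : Continuous r
  continuous_s : Continuous s
  continuous_unit : Continuous unit
  continuous_inv : Continuous inv
  continuous_mul : Continuous fun p : {p : G × G // s p.1 = r p.2} => mul p.1.1 p.1.2 p.2

namespace TopologicalGroupoid

variable {G X : Type*} [TopologicalSpace G] [TopologicalSpace X] (𝒢 : TopologicalGroupoid G X)

/-! ### Orbits of units -/

/-- Two units are equivalent if there is an arrow between them. -/
def orbitSetoid : Setoid X where
  r u v := ∃ γ : G, 𝒢.r γ = u ∧ 𝒢.s γ = v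
  iseqv :=
    { refl := fun u => ⟨𝒢.unit u, 𝒢.r_unit u, 𝒢.s_unit u⟩
      symm := by
        rintro u v ⟨γ, hr, hs⟩
        exact ⟨𝒢.inv γ, (𝒢.r_inv γ).trans hs, (𝒢.s_inv γ).trans hr⟩
      trans := by
        rintro u v w ⟨γ, hr, hs⟩ ⟨η, hr', hs'⟩
        exact ⟨𝒢.mul γ η (hs.trans hr'.symm), (𝒢.r_mul _ _ _).trans hr,
          (𝒢.s_mul _ _ _).trans hs'⟩ }

/-- The orbit space of the groupoid, with the quotient topology. -/
abbrev OrbitSpace : Type _ := Quotient 𝒢.orbitSetoid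

/-! ### The isotropy groupoid and the isotropy groups -/

/-- The arrows of the isotropy groupoid, with the subspace topology. -/
abbrev IsotropyBundle : Type _ := {γ : G // 𝒢.r γ = 𝒢.s γ}

/-- The isotropy groupoid, a topological groupoid with the same unit space. -/
def isotropy : TopologicalGroupoid 𝒢.IsotropyBundle X where
  r a := 𝒢.r a.1
  s a := 𝒢.s a.1
  unit u := ⟨𝒢.unit u, (𝒢.r_unit u).trans (𝒢.s_unit u).symm⟩
  inv a := ⟨𝒢.inv a.1, ((𝒢.r_inv _).trans a.2.symm).trans (𝒢.s_inv _).symm⟩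
  mul a b h := ⟨𝒢.mul a.1 b.1 h,
    (((𝒢.r_mul _ _ h).trans a.2).trans (h.trans b.2)).trans (𝒢.s_mul _ _ h).symm⟩
  r_unit u := 𝒢.r_unit u
  s_unit u := 𝒢.s_unit u
  r_inv a := 𝒢.r_inv a.1
  s_inv a := 𝒢.s_inv a.1
  r_mul a b h := 𝒢.r_mul a.1 b.1 h
  s_mul a b h := 𝒢.s_mul a.1 b.1 h
  mul_assoc a b c h₁ h₂ := Subtype.ext (𝒢.mul_assoc a.1 b.1 c.1 h₁ h₂)
  unit_mul u a h := Subtype.ext (𝒢.unit_mul u a.1 h)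
  mul_unit a u h := Subtype.ext (𝒢.mul_unit a.1 u h)
  mul_inv a := Subtype.ext (𝒢.mul_inv a.1)
  inv_mul a := Subtype.ext (𝒢.inv_mul a.1)
  continuous_r := 𝒢.continuous_r.comp continuous_subtype_val
  continuous_s := 𝒢.continuous_s.comp continuous_subtype_val
  continuous_unit := 𝒢.continuous_unit.subtype_mk _
  continuous_inv := (𝒢.continuous_inv.comp continuous_subtype_val).subtype_mk _
  continuous_mul := by
    refine Continuous.subtype_mk ?_ _
    exact 𝒢.continuous_mul.comp
      (Continuous.subtype_mk (f := fun p : {p : 𝒢.IsotropyBundle × 𝒢.IsotropyBundle //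
          𝒢.s p.1.1 = 𝒢.r p.2.1} => ((p.1.1.1 : G), (p.1.2.1 : G)))
        (by fun_prop) (fun p => p.2))

/-- The isotropy group `A_u` at the unit `u`. -/
def IsotropyGroup (u : X) : Type _ := {γ : G // 𝒢.r γ = u ∧ 𝒢.s γ = u}

namespace IsotropyGroup

variable {𝒢} {u : X}

instance : TopologicalSpace (𝒢.IsotropyGroup u) := instTopologicalSpaceSubtype

instance [MeasurableSpace G] : MeasurableSpace (𝒢.IsotropyGroup u) := Subtype.instMeasurableSpace

instance : Group (𝒢.IsotropyGroup u) where
  mul a b := ⟨𝒢.mul a.1 b.1 (a.2.2.trans b.2.1.symm),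
    (𝒢.r_mul _ _ _).trans a.2.1, (𝒢.s_mul _ _ _).trans b.2.2⟩
  one := ⟨𝒢.unit u, 𝒢.r_unit u, 𝒢.s_unit u⟩
  inv a := ⟨𝒢.inv a.1, (𝒢.r_inv _).trans a.2.2, (𝒢.s_inv _).trans a.2.1⟩
  mul_assoc a b c := Subtype.ext (𝒢.mul_assoc a.1 b.1 c.1 _ _)
  one_mul a := Subtype.ext (𝒢.unit_mul u a.1 _)
  mul_one a := Subtype.ext (𝒢.mul_unit a.1 u _)
  inv_mul_cancel a := Subtype.ext ((𝒢.inv_mul a.1).trans (congrArg 𝒢.unit a.2.2))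

/-- The inclusion of `A_u` in the isotropy groupoid. -/
def toBundle (a : 𝒢.IsotropyGroup u) : 𝒢.IsotropyBundle := ⟨a.1, a.2.1.trans a.2.2.symm⟩

end IsotropyGroup

/-- All isotropy groups are abelian. -/
def AbelianIsotropy : Prop := ∀ (u : X) (a b : 𝒢.IsotropyGroup u), a * b = b * a

/-! ### Continuously varying isotropy -/

/-- The Fell topology on the closed subsets of a space: it is generated by the sets
`{F | F ∩ K = ∅}` for `K` compact and `{F | F ∩ U ≠ ∅}` for `U` open. -/
@[reducible] def fellTopology (Y : Type*) [TopologicalSpace Y] :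
    TopologicalSpace (TopologicalSpace.Closeds Y) :=
  TopologicalSpace.generateFrom
    ({S | ∃ K : Set Y, IsCompact K ∧
        S = {F : TopologicalSpace.Closeds Y | (F : Set Y) ∩ K = ∅}} ∪
     {S | ∃ U : Set Y, IsOpen U ∧
        S = {F : TopologicalSpace.Closeds Y | ((F : Set Y) ∩ U).Nonempty}})

/-- The isotropy group `A_u` as a closed subset of the space of arrows. -/
def isotropyClosed [T2Space G] (u : X) : TopologicalSpace.Closeds G where
  carrier := {γ | 𝒢.r γ = u ∧ 𝒢.s γ = u}
  isClosed' := by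
    have hinj : Function.Injective 𝒢.unit := fun a b h => by
      rw [← 𝒢.r_unit a, h, 𝒢.r_unit]
    have h : {γ | 𝒢.r γ = u ∧ 𝒢.s γ = u} =
        {γ | 𝒢.unit (𝒢.r γ) = 𝒢.unit u} ∩ {γ | 𝒢.unit (𝒢.s γ) = 𝒢.unit u} := by
      ext γ
      simp [hinj.eq_iff]
    rw [h]
    exact (isClosed_eq (𝒢.continuous_unit.comp 𝒢.continuous_r) continuous_const).inter
      (isClosed_eq (𝒢.continuous_unit.comp 𝒢.continuous_s) continuous_const)

/-- The isotropy groups vary continuously: `u ↦ A_u` is continuous in the Fell topology. -/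
def ContinuouslyVaryingIsotropy [T2Space G] : Prop :=
  Continuous[_, fellTopology G] 𝒢.isotropyClosed

/-! ### Haar systems -/

/-- A (left) Haar system: Radon measures `λ^u` on `G` with support `r⁻¹(u)`, such that
`u ↦ ∫ f dλ^u` is continuous and `∫ f(γα) dλ^{s(γ)}(α) = ∫ f(α) dλ^{r(γ)}(α)` for `f ∈ C_c(G)`. -/
structure HaarSystem [MeasurableSpace G] where
  measure : X → Measure G
  regular : ∀ u, (measure u).Regular
  support_eq : ∀ u, (measure u).support = 𝒢.r ⁻¹' {u}
  continuous_integral : ∀ f : CompactlySupportedContinuousMap G ℂ,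
    Continuous fun u => ∫ γ, f γ ∂(measure u)
  left_invariant : ∀ (γ : G) (f : CompactlySupportedContinuousMap G ℂ),
    ∫ α : {α : G // 𝒢.s γ = 𝒢.r α}, f (𝒢.mul γ α.1 α.2)
        ∂((measure (𝒢.s γ)).comap Subtype.val) =
      ∫ α, f α ∂(measure (𝒢.r γ))

/-! ### The dual of the isotropy groupoid -/

/-- The spectrum of the commutative `C*`-algebra of the isotropy groupoid with respect to a Haar
system `β`, as a set: pairs of a unit `u` and a continuous character `χ` of `A_u`. The Haar system
enters only through the topology below. -/
structure DualIsotropy {𝒢 : TopologicalGroupoid G X} [MeasurableSpace G]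
    (β : 𝒢.isotropy.HaarSystem) where
  base : X
  char : PontryaginDual (𝒢.IsotropyGroup base)

namespace DualIsotropy

variable {𝒢} [MeasurableSpace G] {β : 𝒢.isotropy.HaarSystem}

/-- The pair `(χ, u)` as a functional on compactly supported functions on the isotropy groupoid:
`(χ, u)(f) = ∫ χ(a) f(a) dβ^u(a)`, the integral being over `A_u`. -/
noncomputable def eval (p : DualIsotropy β)
    (f : CompactlySupportedContinuousMap 𝒢.IsotropyBundle ℂ) : ℂ :=
  ∫ a : 𝒢.IsotropyGroup p.base, (p.char a : ℂ) * f a.toBundle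
    ∂((β.measure p.base).comap IsotropyGroup.toBundle)

/-- The topology of the spectrum, that is, the weak-* topology. It is the topology of pointwise
convergence on the compactly supported functions, because these are dense in the `C*`-algebra and
characters of a `C*`-algebra are contractive. -/
noncomputable instance : TopologicalSpace (DualIsotropy β) :=
  TopologicalSpace.induced eval Pi.topologicalSpace

end DualIsotropy

/-! ### The quotient of the groupoid by its isotropy, and its action on the dual -/

/-- Two arrows `γ`, `η` are equivalent if `η = γa` for some `a` in the isotropy groupoid. -/
def isotropySetoid : Setoid G where
  r γ η := ∃ (a : 𝒢.IsotropyBundle) (h : 𝒢.s γ = 𝒢.r a.1), 𝒢.mul γ a.1 h = η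
  iseqv :=
    { refl := fun γ => ⟨𝒢.isotropy.unit (𝒢.s γ), (𝒢.r_unit _).symm, 𝒢.mul_unit _ _ _⟩
      symm := by
        rintro γ _ ⟨a, h, rfl⟩
        refine ⟨𝒢.isotropy.inv a, (𝒢.s_mul _ _ _).trans (𝒢.r_inv _).symm, ?_⟩
        change 𝒢.mul (𝒢.mul γ a.1 h) (𝒢.inv a.1) _ = γ
        rw [𝒢.mul_assoc γ a.1 (𝒢.inv a.1) h (𝒢.r_inv _).symm]
        simp only [𝒢.mul_inv, 𝒢.mul_unit]
      trans := by
        rintro γ _ _ ⟨a, h, rfl⟩ ⟨b, h', rfl⟩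
        have hab : 𝒢.s a.1 = 𝒢.r b.1 := (𝒢.s_mul _ _ _).symm.trans h'
        exact ⟨𝒢.isotropy.mul a b hab, h.trans (𝒢.r_mul _ _ _).symm,
          (𝒢.mul_assoc γ a.1 b.1 h hab).symm⟩ }

/-- The quotient `ℛ` of the groupoid by its isotropy groupoid. -/
abbrev IsotropyQuotient : Type _ := Quotient 𝒢.isotropySetoid

namespace IsotropyQuotient

variable {𝒢}

/-- The range map of `ℛ`. -/
def range : 𝒢.IsotropyQuotient → X :=
  Quotient.lift 𝒢.r (by
    rintro γ _ ⟨a, h, rfl⟩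
    exact (𝒢.r_mul _ _ _).symm)

/-- The source map of `ℛ`. -/
def source : 𝒢.IsotropyQuotient → X :=
  Quotient.lift 𝒢.s (by
    rintro γ _ ⟨a, h, rfl⟩
    exact (h.trans a.2).trans (𝒢.s_mul _ _ _).symm)

end IsotropyQuotient

theorem inv_mul_rev (γ η : G) (h : 𝒢.s γ = 𝒢.r η) :
    𝒢.inv (𝒢.mul γ η h) = 𝒢.mul (𝒢.inv η) (𝒢.inv γ)
      ((𝒢.s_inv η).trans (h.symm.trans (𝒢.r_inv γ).symm)) := by
  have key : ∀ x y (hxy : 𝒢.s x = 𝒢.r y), 𝒢.mul x y hxy = 𝒢.unit (𝒢.r x) → 𝒢.inv x = y := by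
    intro x y hxy e
    have h1 := 𝒢.mul_assoc (𝒢.inv x) x y (𝒢.s_inv x) hxy
    simp only [𝒢.inv_mul, e, 𝒢.unit_mul, 𝒢.mul_unit] at h1
    exact h1.symm
  refine key _ _ ((𝒢.s_mul _ _ _).trans ((𝒢.r_inv η).symm.trans (𝒢.r_mul _ _ _).symm)) ?_
  rw [𝒢.mul_assoc γ η _ h ((𝒢.r_inv η).symm.trans (𝒢.r_mul _ _ _).symm)]
  have h2 := 𝒢.mul_assoc η (𝒢.inv η) (𝒢.inv γ) (𝒢.r_inv η).symm
    ((𝒢.s_inv η).trans (h.symm.trans (𝒢.r_inv γ).symm))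
  simp only [← h2, 𝒢.mul_inv, 𝒢.unit_mul, 𝒢.r_mul]

/-- Conjugation `a ↦ γaγ⁻¹` as a continuous homomorphism from `A_{s(γ)}` to `A_u`, where
`u = r(γ)`. -/
def conj {u : X} (γ : G) (hu : 𝒢.r γ = u) :
    𝒢.IsotropyGroup (𝒢.s γ) →ₜ* 𝒢.IsotropyGroup u where
  toFun a := ⟨𝒢.mul (𝒢.mul γ a.1 a.2.1.symm) (𝒢.inv γ)
      (((𝒢.s_mul _ _ _).trans a.2.2).trans (𝒢.r_inv γ).symm),
    ((𝒢.r_mul _ _ _).trans (𝒢.r_mul _ _ _)).trans hu,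
    ((𝒢.s_mul _ _ _).trans (𝒢.s_inv γ)).trans hu⟩
  map_one' := by
    subst hu
    apply Subtype.ext
    change 𝒢.mul (𝒢.mul γ (𝒢.unit (𝒢.s γ)) _) (𝒢.inv γ) _ = 𝒢.unit (𝒢.r γ)
    simp only [𝒢.mul_unit, 𝒢.mul_inv]
  map_mul' a b := by
    apply Subtype.ext
    have ha : 𝒢.s γ = 𝒢.r a.1 := a.2.1.symm
    have hb : 𝒢.s γ = 𝒢.r b.1 := b.2.1.symm
    have hab : 𝒢.s a.1 = 𝒢.r b.1 := a.2.2.trans hb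
    have hbi : 𝒢.s b.1 = 𝒢.r (𝒢.inv γ) := b.2.2.trans (𝒢.r_inv γ).symm
    have hai : 𝒢.s a.1 = 𝒢.r (𝒢.inv γ) := a.2.2.trans (𝒢.r_inv γ).symm
    have hii : 𝒢.s (𝒢.inv γ) = 𝒢.r γ := 𝒢.s_inv γ
    change 𝒢.mul (𝒢.mul γ (𝒢.mul a.1 b.1 hab) _) (𝒢.inv γ) _ =
      𝒢.mul (𝒢.mul (𝒢.mul γ a.1 ha) (𝒢.inv γ) _) (𝒢.mul (𝒢.mul γ b.1 hb) (𝒢.inv γ) _) _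
    rw [𝒢.mul_assoc (𝒢.mul γ a.1 ha) (𝒢.inv γ) _ ((𝒢.s_mul _ _ _).trans hai)
      (hii.trans ((𝒢.r_mul _ _ _).trans (𝒢.r_mul _ _ _)).symm)]
    have e1 := 𝒢.mul_assoc (𝒢.inv γ) (𝒢.mul γ b.1 hb) (𝒢.inv γ)
      (hii.trans (𝒢.r_mul _ _ _).symm) ((𝒢.s_mul _ _ _).trans hbi)
    have e2 := 𝒢.mul_assoc (𝒢.inv γ) γ b.1 hii hb
    have e3 := 𝒢.mul_assoc (𝒢.mul γ a.1 ha) b.1 (𝒢.inv γ) ((𝒢.s_mul _ _ _).trans hab) hbi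
    have e4 := 𝒢.mul_assoc γ a.1 b.1 ha hab
    simp only [← e1, ← e2, ← e3, ← e4, 𝒢.inv_mul, 𝒢.unit_mul]
  continuous_toFun := by
    have c1 : Continuous fun a : 𝒢.IsotropyGroup (𝒢.s γ) => 𝒢.mul γ a.1 a.2.1.symm :=
      𝒢.continuous_mul.comp (Continuous.subtype_mk
        (f := fun a : 𝒢.IsotropyGroup (𝒢.s γ) => (γ, a.1))
        (continuous_const.prodMk continuous_subtype_val) (fun a => a.2.1.symm))
    refine Continuous.subtype_mk ?_ _
    exact 𝒢.continuous_mul.comp (Continuous.subtype_mk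
      (f := fun a : 𝒢.IsotropyGroup (𝒢.s γ) => (𝒢.mul γ a.1 a.2.1.symm, 𝒢.inv γ))
      (c1.prodMk continuous_const)
      (fun a => ((𝒢.s_mul _ _ _).trans a.2.2).trans (𝒢.r_inv γ).symm))

namespace DualIsotropy

variable {𝒢} [MeasurableSpace G] {β : 𝒢.isotropy.HaarSystem}

/-- The right action of an arrow `γ` on a pair `(χ, u)` with `r(γ) = u`:
`(χ, u) · γ = (χ · γ, s(γ))`, where `χ · γ (a) = χ(γaγ⁻¹)` for `a ∈ A_{s(γ)}`. -/
noncomputable def act (p : DualIsotropy β) (γ : G) (h : 𝒢.r γ = p.base) : DualIsotropy β :=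
  ⟨𝒢.s γ, PontryaginDual.map (𝒢.conj γ h) p.char⟩

theorem ext_of_apply {p q : DualIsotropy β} (h : p.base = q.base)
    (h' : ∀ (a : 𝒢.IsotropyGroup p.base) (b : 𝒢.IsotropyGroup q.base), a.1 = b.1 →
      p.char a = q.char b) : p = q := by
  obtain ⟨u, χ⟩ := p
  obtain ⟨v, ψ⟩ := q
  obtain rfl : u = v := h
  congr 1
  exact PontryaginDual.ext fun a => h' a a rfl

theorem act_unit (p : DualIsotropy β) : p.act (𝒢.unit p.base) (𝒢.r_unit _) = p := by
  refine ext_of_apply (𝒢.s_unit _) fun a b hab => ?_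
  change p.char (𝒢.conj _ _ a) = p.char b
  congr 1
  apply Subtype.ext
  change 𝒢.mul (𝒢.mul _ a.1 _) (𝒢.inv _) _ = b.1
  have hu : 𝒢.inv (𝒢.unit p.base) = 𝒢.unit p.base := by
    have h1 := 𝒢.mul_inv (𝒢.unit p.base)
    simpa only [𝒢.unit_mul, 𝒢.r_unit] using h1
  simp only [hu, 𝒢.unit_mul, 𝒢.mul_unit, hab]

theorem act_mul (p : DualIsotropy β) (γ η : G) (h : 𝒢.r γ = p.base) (h' : 𝒢.s γ = 𝒢.r η) :
    p.act (𝒢.mul γ η h') ((𝒢.r_mul _ _ _).trans h) = (p.act γ h).act η h'.symm := by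
  refine ext_of_apply (𝒢.s_mul _ _ _) fun a b hab => ?_
  change p.char (𝒢.conj _ _ a) = p.char (𝒢.conj _ _ (𝒢.conj _ _ b))
  congr 1
  apply Subtype.ext
  change 𝒢.mul (𝒢.mul (𝒢.mul γ η h') a.1 _) (𝒢.inv (𝒢.mul γ η h')) _ =
    𝒢.mul (𝒢.mul γ (𝒢.mul (𝒢.mul η b.1 _) (𝒢.inv η) _) _) (𝒢.inv γ) _
  obtain ⟨a, ha⟩ := a
  obtain ⟨b, hb⟩ := b
  obtain rfl : a = b := hab
  have hηa : 𝒢.s η = 𝒢.r a := hb.1.symm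
  have hai : 𝒢.s a = 𝒢.r (𝒢.inv η) := hb.2.trans (𝒢.r_inv η).symm
  have hii : 𝒢.s (𝒢.inv η) = 𝒢.r (𝒢.inv γ) := (𝒢.s_inv η).trans (h'.symm.trans (𝒢.r_inv γ).symm)
  have e1 := 𝒢.mul_assoc γ η a h' hηa
  have e2 := 𝒢.mul_assoc γ (𝒢.mul η a hηa) (𝒢.inv η) (h'.trans (𝒢.r_mul _ _ _).symm)
    ((𝒢.s_mul _ _ _).trans hai)
  have e3 := 𝒢.mul_assoc (𝒢.mul γ (𝒢.mul η a hηa) (h'.trans (𝒢.r_mul _ _ _).symm)) (𝒢.inv η)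
    (𝒢.inv γ) (((𝒢.s_mul _ _ _).trans (𝒢.s_mul _ _ _)).trans hai) hii
  simp only [𝒢.inv_mul_rev, ← e3, ← e2, e1]

/-- If the isotropy is abelian, then the isotropy groupoid acts trivially on its dual. -/
theorem act_isotropy (hab : 𝒢.AbelianIsotropy) (p : DualIsotropy β) (a : 𝒢.IsotropyBundle)
    (h : 𝒢.r a.1 = p.base) : p.act a.1 h = p := by
  refine ext_of_apply (a.2.symm.trans h) fun b c hbc => ?_
  change p.char (𝒢.conj _ _ b) = p.char c
  congr 1
  let a' : 𝒢.IsotropyGroup p.base := ⟨a.1, h, a.2.symm.trans h⟩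
  have e' : 𝒢.conj a.1 h b = a' * c * a'⁻¹ := by
    apply Subtype.ext
    change 𝒢.mul (𝒢.mul a.1 b.1 _) (𝒢.inv a.1) _ = 𝒢.mul (𝒢.mul a.1 c.1 _) (𝒢.inv a.1) _
    simp only [hbc]
  rw [e', hab p.base a' c, mul_inv_cancel_right]

theorem act_congr (hab : 𝒢.AbelianIsotropy) (p : DualIsotropy β) {γ η : G}
    (hγη : 𝒢.isotropySetoid γ η) (h : 𝒢.r γ = p.base) (h' : 𝒢.r η = p.base) :
    p.act γ h = p.act η h' := by
  obtain ⟨a, ha, rfl⟩ := hγη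
  exact ((act_mul p γ a.1 h ha).trans (act_isotropy hab _ a ha.symm)).symm

/-- The right action of `ℛ` on the dual of the isotropy groupoid: `(χ, u) · [γ] = (χ · γ, s(γ))`
for `r(γ) = u`. -/
noncomputable def quotientAct (hab : 𝒢.AbelianIsotropy) (p : DualIsotropy β) (ρ : 𝒢.IsotropyQuotient)
    (h : IsotropyQuotient.range ρ = p.base) : DualIsotropy β :=
  Quotient.hrecOn (motive := fun ρ => IsotropyQuotient.range ρ = p.base → DualIsotropy β) ρ
    (fun γ h => p.act γ h)
    (fun γ η hγη => Function.hfunext (by rw [Quotient.sound hγη])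
      (fun h h' _ => heq_of_eq (act_congr hab p hγη h h'))) h

theorem quotientAct_mk (hab : 𝒢.AbelianIsotropy) (p : DualIsotropy β) (γ : G)
    (h : 𝒢.r γ = p.base) : p.quotientAct hab (Quotient.mk 𝒢.isotropySetoid γ) h = p.act γ h := rfl

theorem base_quotientAct (hab : 𝒢.AbelianIsotropy) (p : DualIsotropy β) (ρ : 𝒢.IsotropyQuotient)
    (h : IsotropyQuotient.range ρ = p.base) :
    (p.quotientAct hab ρ h).base = IsotropyQuotient.source ρ := by
  induction ρ using Quotient.inductionOn with
  | h γ => rfl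

/-- The orbit equivalence relation of the action of `ℛ` on the dual of the isotropy groupoid. -/
def orbitSetoid (hab : 𝒢.AbelianIsotropy) (β : 𝒢.isotropy.HaarSystem) :
    Setoid (DualIsotropy β) where
  r p q := ∃ (ρ : 𝒢.IsotropyQuotient) (h : IsotropyQuotient.range ρ = p.base),
    p.quotientAct hab ρ h = q
  iseqv :=
    { refl := fun p => ⟨Quotient.mk _ (𝒢.unit p.base), 𝒢.r_unit _, act_unit p⟩
      symm := by
        rintro p _ ⟨ρ, h, rfl⟩
        induction ρ using Quotient.inductionOn with
        | h γ =>
          have h : 𝒢.r γ = p.base := h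
          refine ⟨Quotient.mk _ (𝒢.inv γ), 𝒢.r_inv γ, ?_⟩
          change (p.act γ h).act (𝒢.inv γ) (𝒢.r_inv γ) = p
          rw [← act_mul p γ (𝒢.inv γ) h (𝒢.r_inv γ).symm]
          simp only [𝒢.mul_inv, h]
          exact act_unit p
      trans := by
        rintro p _ _ ⟨ρ, h, rfl⟩ ⟨σ, h', rfl⟩
        induction ρ using Quotient.inductionOn with
        | h γ =>
          induction σ using Quotient.inductionOn with
          | h η =>
            have h : 𝒢.r γ = p.base := h
            have h' : 𝒢.r η = 𝒢.s γ := h'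
            exact ⟨Quotient.mk _ (𝒢.mul γ η h'.symm), (𝒢.r_mul _ _ _).trans h,
              act_mul p γ η h h'.symm⟩ }

/-- The orbit space of the action of `ℛ` on the dual, with the quotient topology. -/
abbrev OrbitSpace (hab : 𝒢.AbelianIsotropy) (β : 𝒢.isotropy.HaarSystem) : Type _ :=
  Quotient (orbitSetoid hab β)

end DualIsotropy

end TopologicalGroupoid

set_option linter.unusedSectionVars false

/-! ### Topology of the unit space and of the isotropy groups -/

namespace TopologicalGroupoid

variable {G X : Type*} [TopologicalSpace G] [TopologicalSpace X] (𝒢 : TopologicalGroupoid G X)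

/-! A quotient is T₁ exactly when every class is closed, so the equivalence compares closed orbits
of units with closed orbits in the dual.

From the dual to the units: `u ↦ (1, u)` is continuous, because evaluation at trivial characters is
integration against the Haar system (`continuous_trivial`), and it pulls the orbit of `(1, u)` back
to the orbit of `u`.

From the units to the dual: a closed orbit of units is locally compact Hausdorff, hence Baire, and
it is the image under the source map of the σ-compact set `r⁻¹(u)`. Baire category, together with
the openness of `r`, shows that locally it consists of the sources of a compact set of arrows
(`exists_isCompact_source`). Abelian isotropy acts trivially on its dual, so the action of an arrow
on `(χ, u)` depends only on the source of the arrow (`act_eq_act`). Hence, near a limit point, the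
orbit of `(χ, u)` lies in the image of a compact set under the continuous action
(`DualIsotropy.continuous_act`). That image is closed, as the dual is Hausdorff.

The Haar system on the isotropy comes from arbitrary Haar measures on the isotropy groups by
rescaling. Near `u₀`, divide by the integral of a function `F ≥ 0` positive at the unit. The ratios
are bounded, and each of their ultrafilter limits is a left invariant positive functional on
`A_{u₀}`, so uniqueness of Haar measure identifies the limit (`tendsto_fiberIntegral_div`). Positive
multiples of one Haar integral form a convex set, so a partition of unity glues the local
normalizations. -/

theorem isClosedEmbedding_unit [T2Space G] : IsClosedEmbedding 𝒢.unit := by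
  refine ⟨(Function.LeftInverse.isEmbedding 𝒢.r_unit 𝒢.continuous_r 𝒢.continuous_unit), ?_⟩
  have : Set.range 𝒢.unit = {γ | 𝒢.unit (𝒢.r γ) = γ} := by
    ext γ
    constructor
    · rintro ⟨u, rfl⟩
      exact congrArg 𝒢.unit (𝒢.r_unit u)
    · exact fun h => ⟨_, h⟩
  rw [this]
  exact isClosed_eq (𝒢.continuous_unit.comp 𝒢.continuous_r) continuous_id

/-- The unit space carries no hypotheses of its own: it inherits them from the arrows, through the
closed embedding of the units. -/
theorem t2Space_units (𝒢 : TopologicalGroupoid G X) [T2Space G] : T2Space X := 𝒢.isClosedEmbedding_unit.isEmbedding.t2Space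

theorem locallyCompactSpace_units (𝒢 : TopologicalGroupoid G X) [T2Space G] [LocallyCompactSpace G] : LocallyCompactSpace X :=
  𝒢.isClosedEmbedding_unit.locallyCompactSpace

theorem secondCountableTopology_units (𝒢 : TopologicalGroupoid G X) [T2Space G] [SecondCountableTopology G] :
    SecondCountableTopology X :=
  𝒢.isClosedEmbedding_unit.isEmbedding.secondCountableTopology

theorem isClosed_isotropyBundle [T2Space G] : IsClosed {γ : G | 𝒢.r γ = 𝒢.s γ} :=
  have := 𝒢.t2Space_units
  isClosed_eq 𝒢.continuous_r 𝒢.continuous_s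

instance [T2Space G] [LocallyCompactSpace G] : LocallyCompactSpace 𝒢.IsotropyBundle :=
  𝒢.isClosed_isotropyBundle.isClosedEmbedding_subtypeVal.locallyCompactSpace

instance [SecondCountableTopology G] : SecondCountableTopology 𝒢.IsotropyBundle :=
  TopologicalSpace.Subtype.secondCountableTopology _

namespace IsotropyGroup

variable {𝒢} {u : X}

theorem toBundle_injective : Function.Injective (toBundle : 𝒢.IsotropyGroup u → 𝒢.IsotropyBundle) :=
  fun _ _ h => Subtype.ext (congrArg (fun x : 𝒢.IsotropyBundle => x.1) h)

theorem range_toBundle : Set.range (toBundle : 𝒢.IsotropyGroup u → 𝒢.IsotropyBundle) =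
    𝒢.isotropy.r ⁻¹' {u} := by
  ext a
  constructor
  · rintro ⟨a, rfl⟩
    exact a.2.1
  · intro h
    exact ⟨⟨a.1, h, a.2.symm.trans h⟩, rfl⟩

theorem r_toBundle (a : 𝒢.IsotropyGroup u) : 𝒢.isotropy.r a.toBundle = u := a.2.1

theorem s_toBundle (a : 𝒢.IsotropyGroup u) : 𝒢.isotropy.s a.toBundle = u := a.2.2

theorem isClosedEmbedding_toBundle [T2Space G] :
    IsClosedEmbedding (toBundle : 𝒢.IsotropyGroup u → 𝒢.IsotropyBundle) := by
  have := 𝒢.t2Space_units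
  refine ⟨⟨⟨?_⟩, toBundle_injective⟩, ?_⟩
  · rw [instTopologicalSpaceSubtype, induced_compose]
    rfl
  · rw [range_toBundle]
    exact isClosed_singleton.preimage 𝒢.isotropy.continuous_r

theorem continuous_toBundle : Continuous (toBundle : 𝒢.IsotropyGroup u → 𝒢.IsotropyBundle) :=
  Continuous.subtype_mk continuous_subtype_val _

theorem toBundle_mul (a b : 𝒢.IsotropyGroup u) : (a * b).toBundle =
    𝒢.isotropy.mul a.toBundle b.toBundle (a.2.2.trans b.2.1.symm) := rfl

instance [T2Space G] : T2Space (𝒢.IsotropyGroup u) := inferInstanceAs (T2Space (Subtype _))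

instance [SecondCountableTopology G] : SecondCountableTopology (𝒢.IsotropyGroup u) :=
  TopologicalSpace.Subtype.secondCountableTopology _

instance [T2Space G] [LocallyCompactSpace G] : LocallyCompactSpace (𝒢.IsotropyGroup u) :=
  isClosedEmbedding_toBundle.locallyCompactSpace

instance [MeasurableSpace G] [BorelSpace G] : BorelSpace (𝒢.IsotropyGroup u) :=
  inferInstanceAs (BorelSpace (Subtype _))

instance : IsTopologicalGroup (𝒢.IsotropyGroup u) where
  continuous_mul := Continuous.subtype_mk (𝒢.continuous_mul.comp
    (Continuous.subtype_mk (f := fun p : 𝒢.IsotropyGroup u × 𝒢.IsotropyGroup u => (p.1.1, p.2.1))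
      ((continuous_subtype_val.comp continuous_fst).prodMk
        (continuous_subtype_val.comp continuous_snd)) (fun p => p.1.2.2.trans p.2.2.1.symm))) _
  continuous_inv := Continuous.subtype_mk (𝒢.continuous_inv.comp continuous_subtype_val) _

/-- The restriction of compactly supported functions to an isotropy group is surjective. -/
theorem exists_restrict_eq [T2Space G] [LocallyCompactSpace G] [SecondCountableTopology G]
    (f : CompactlySupportedContinuousMap (𝒢.IsotropyGroup u) ℝ) :
    ∃ g : CompactlySupportedContinuousMap 𝒢.IsotropyBundle ℝ, ∀ a, g a.toBundle = f a := by
  obtain ⟨h, hh⟩ := ContinuousMap.exists_extension' (isClosedEmbedding_toBundle (𝒢 := 𝒢) (u := u))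
    f.toContinuousMap
  have hK : IsCompact (toBundle '' tsupport f) :=
    IsCompact.image f.hasCompactSupport continuous_toBundle
  -- The Tietze extension `h` need not have compact support, hence the cutoff `k`, equal to 1 on the
  -- image of the support of `f`.
  obtain ⟨k, hk1, -, hkc, -⟩ := exists_continuous_one_zero_of_isCompact hK isClosed_empty
    (Set.disjoint_empty _)
  refine ⟨⟨h * k, hkc.mul_left⟩, fun a => ?_⟩
  change h a.toBundle * k a.toBundle = f a
  have h1 : h a.toBundle = f a := congrFun hh a
  by_cases ha : a ∈ tsupport f
  · rw [hk1 ⟨a, ha, rfl⟩, h1]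
    simp
  · rw [h1, image_eq_zero_of_notMem_tsupport ha, zero_mul]

end IsotropyGroup

end TopologicalGroupoid

/-! ### Compactly supported test functions -/

theorem CompactlySupportedContinuousMap.exists_bump {Y : Type*} [TopologicalSpace Y] [T2Space Y]
    [LocallyCompactSpace Y] {y : Y} {U : Set Y} (hU : U ∈ 𝓝 y) :
    ∃ f : CompactlySupportedContinuousMap Y ℝ, f y = 1 ∧ (∀ x, 0 ≤ f x) ∧ ∀ x ∉ U, f x = 0 := by
  obtain ⟨f, h1, h0, hc, h01⟩ := exists_continuous_one_zero_of_isCompact (isCompact_singleton (x := y))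
    (isOpen_interior (s := U)).isClosed_compl
    (Set.disjoint_singleton_left.2 fun h => h (mem_interior_iff_mem_nhds.2 hU))
  exact ⟨⟨f, hc⟩, h1 rfl, fun x => (h01 x).1, fun x hx => h0 fun h => hx (interior_subset h)⟩

theorem CompactlySupportedContinuousMap.exists_ofReal {Y : Type*} [TopologicalSpace Y]
    (f : CompactlySupportedContinuousMap Y ℝ) :
    ∃ g : CompactlySupportedContinuousMap Y ℂ, ∀ y, g y = (f y : ℂ) :=
  ⟨⟨⟨fun y => (f y : ℂ), Complex.continuous_ofReal.comp f.continuous⟩,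
    f.hasCompactSupport.comp_left Complex.ofReal_zero⟩, fun _ => rfl⟩

/-! ### Haar systems: openness of the range map, Haar measures on the isotropy groups -/

namespace TopologicalGroupoid

variable {G X : Type*} [TopologicalSpace G] [TopologicalSpace X] {𝒢 : TopologicalGroupoid G X}

namespace IsotropyGroup

variable [MeasurableSpace G] [BorelSpace G] [T2Space G] {u : X}

theorem measurableEmbedding_toBundle :
    MeasurableEmbedding (toBundle : 𝒢.IsotropyGroup u → 𝒢.IsotropyBundle) :=
  isClosedEmbedding_toBundle.measurableEmbedding

theorem integral_comap_toBundle {E : Type*} [NormedAddCommGroup E] [NormedSpace ℝ E]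
    {m : Measure 𝒢.IsotropyBundle} (hm : m (𝒢.isotropy.r ⁻¹' {u})ᶜ = 0)
    (f : 𝒢.IsotropyBundle → E) :
    ∫ a : 𝒢.IsotropyGroup u, f a.toBundle ∂(m.comap toBundle) = ∫ a, f a ∂m := by
  rw [← measurableEmbedding_toBundle.integral_map, measurableEmbedding_toBundle.map_comap,
    range_toBundle]
  congr 1
  exact Measure.restrict_eq_self_of_ae_mem hm

end IsotropyGroup

namespace HaarSystem

variable [MeasurableSpace G]

theorem continuous_integral_real (β : 𝒢.HaarSystem) (f : CompactlySupportedContinuousMap G ℝ) :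
    Continuous fun u => ∫ γ, f γ ∂(β.measure u) := by
  obtain ⟨g, hg⟩ := f.exists_ofReal
  have h := Complex.continuous_re.comp (β.continuous_integral g)
  convert h using 2 with u
  simp only [Function.comp_apply, hg]
  rw [show ∫ γ, (f γ : ℂ) ∂(β.measure u) = ((∫ γ, f γ ∂(β.measure u) : ℝ) : ℂ) from
    integral_complex_ofReal, Complex.ofReal_re]

theorem measure_compl_fiber [OpensMeasurableSpace G] (β : 𝒢.HaarSystem) (u : X) :
    β.measure u (𝒢.r ⁻¹' {u})ᶜ = 0 := by
  have := β.regular u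
  rw [← β.support_eq u]
  exact Measure.measure_compl_support_of_regular

theorem measure_pos_of_mem_nhds (β : 𝒢.HaarSystem) {γ : G} {U : Set G} (hU : U ∈ 𝓝 γ) :
    0 < β.measure (𝒢.r γ) U := by
  have h : γ ∈ (β.measure (𝒢.r γ)).support := by
    rw [β.support_eq]
    rfl
  exact (Measure.mem_support_iff_forall γ).1 h U hU

theorem integral_pos [BorelSpace G] (β : 𝒢.HaarSystem) (γ : G)
    (f : CompactlySupportedContinuousMap G ℝ) (hf : ∀ x, 0 ≤ f x) (hγ : f γ ≠ 0) :
    0 < ∫ x, f x ∂(β.measure (𝒢.r γ)) := by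
  have := β.regular (𝒢.r γ)
  rw [integral_pos_iff_support_of_nonneg hf
    (f.continuous.integrable_of_hasCompactSupport f.hasCompactSupport)]
  exact β.measure_pos_of_mem_nhds (f.continuous.isOpen_support.mem_nhds hγ)

/-- A bump function at `γ` has positive integral over the fibre of `r(γ)`, hence over all nearby
fibres by continuity; a fibre with positive integral must meet the support of the bump. -/
theorem isOpenMap_r [BorelSpace G] [T2Space G] [LocallyCompactSpace G] (β : 𝒢.HaarSystem) :
    IsOpenMap 𝒢.r := by
  refine IsOpenMap.of_nhds_le fun γ U hU => ?_
  obtain ⟨f, h1, hf, h0⟩ := CompactlySupportedContinuousMap.exists_bump (Filter.mem_map.1 hU)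
  have hpos := β.integral_pos γ f hf (by simp [h1])
  filter_upwards [(β.continuous_integral_real f).continuousAt.eventually (lt_mem_nhds hpos)] with u hu
  by_contra hn
  have hz : f =ᵐ[β.measure u] 0 := by
    have hm : (𝒢.r ⁻¹' {u}) ∈ ae (β.measure u) := β.measure_compl_fiber u
    filter_upwards [hm] with α hα
    refine h0 α fun hα' => hn ?_
    rw [← show 𝒢.r α = u from hα]
    exact hα'
  rw [integral_congr_ae hz] at hu
  simp at hu

/-- The Haar system on the isotropy groupoid, restricted to an isotropy group. -/
noncomputable def fiberMeasure (β : 𝒢.isotropy.HaarSystem) (u : X) :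
    Measure (𝒢.IsotropyGroup u) :=
  (β.measure u).comap IsotropyGroup.toBundle

variable [BorelSpace G] [T2Space G]

theorem integral_fiberMeasure {E : Type*} [NormedAddCommGroup E] [NormedSpace ℝ E]
    (β : 𝒢.isotropy.HaarSystem) (u : X) (f : 𝒢.IsotropyBundle → E) :
    ∫ a, f a.toBundle ∂(β.fiberMeasure u) = ∫ a, f a ∂(β.measure u) :=
  IsotropyGroup.integral_comap_toBundle (β.measure_compl_fiber u) f

instance (β : 𝒢.isotropy.HaarSystem) (u : X) :
    IsFiniteMeasureOnCompacts (β.fiberMeasure u) where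
  lt_top_of_isCompact K hK := by
    have := β.regular u
    rw [fiberMeasure, IsotropyGroup.measurableEmbedding_toBundle.comap_apply]
    exact (hK.image IsotropyGroup.continuous_toBundle).measure_lt_top

instance (β : 𝒢.isotropy.HaarSystem) (u : X) : (β.fiberMeasure u).IsOpenPosMeasure where
  open_pos U hU hne := by
    obtain ⟨a, ha⟩ := hne
    obtain ⟨V, hV, rfl⟩ := IsotropyGroup.isClosedEmbedding_toBundle.isInducing.isOpen_iff.1 hU
    rw [fiberMeasure, IsotropyGroup.measurableEmbedding_toBundle.comap_apply,
      Set.image_preimage_eq_inter_range, IsotropyGroup.range_toBundle,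
      measure_inter_conull (β.measure_compl_fiber u)]
    have h := β.measure_pos_of_mem_nhds (hV.mem_nhds ha)
    rw [a.r_toBundle] at h
    exact h.ne'

/-- Left invariance with the integral over composable arrows replaced by one over all arrows. The
values of `φ` off the composable arrows are irrelevant, since they form a null set. -/
theorem integral_mul_left (β : 𝒢.isotropy.HaarSystem) (γ : 𝒢.IsotropyBundle)
    (f : CompactlySupportedContinuousMap 𝒢.IsotropyBundle ℂ) {φ : 𝒢.IsotropyBundle → ℂ}
    (hφ : ∀ α h, φ α = f (𝒢.isotropy.mul γ α h)) :
    ∫ α, φ α ∂(β.measure (𝒢.isotropy.s γ)) = ∫ α, f α ∂(β.measure (𝒢.isotropy.r γ)) := by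
  have := 𝒢.t2Space_units
  rw [← β.left_invariant]
  have hS : MeasurableSet {α : 𝒢.IsotropyBundle | 𝒢.isotropy.s γ = 𝒢.isotropy.r α} :=
    (isClosed_eq continuous_const 𝒢.isotropy.continuous_r).measurableSet
  have h1 : (β.measure (𝒢.isotropy.s γ)).restrict
      {α : 𝒢.IsotropyBundle | 𝒢.isotropy.s γ = 𝒢.isotropy.r α} = β.measure (𝒢.isotropy.s γ) := by
    refine Measure.restrict_eq_self_of_ae_mem ?_
    filter_upwards [show (𝒢.isotropy.r ⁻¹' {𝒢.isotropy.s γ}) ∈ ae (β.measure (𝒢.isotropy.s γ)) from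
      β.measure_compl_fiber _] with α hα using (Set.mem_singleton_iff.1 hα).symm
  conv_lhs => rw [← h1, ← integral_subtype_comap hS]
  refine integral_congr_ae (Filter.Eventually.of_forall fun α => ?_)
  exact hφ _ _

variable [LocallyCompactSpace G] [SecondCountableTopology G]

instance (β : 𝒢.isotropy.HaarSystem) (u : X) : (β.fiberMeasure u).IsMulLeftInvariant where
  map_mul_left_eq_self b := by
    have hc : Continuous fun a => b * a := continuous_const_mul b
    have : IsFiniteMeasureOnCompacts ((β.fiberMeasure u).map (b * ·)) :=
      Measure.IsFiniteMeasureOnCompacts.map _ (Homeomorph.mulLeft b)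
    refine Measure.ext_of_integral_eq_on_compactlySupported fun f => ?_
    -- Invariance of the system is stated for complex functions on the whole isotropy groupoid, so
    -- the real test function on one group is first extended and then made complex.
    obtain ⟨g, hg⟩ := IsotropyGroup.exists_restrict_eq f
    obtain ⟨k, hk⟩ := g.exists_ofReal
    rw [integral_map hc.aemeasurable (map_continuous f).aestronglyMeasurable]
    apply Complex.ofReal_injective
    rw [← integral_complex_ofReal, ← integral_complex_ofReal]
    classical
    obtain ⟨φ, hφ⟩ : ∃ φ : 𝒢.IsotropyBundle → ℂ,
        ∀ α h, φ α = k (𝒢.isotropy.mul b.toBundle α h) :=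
      ⟨fun α => if h : _ then k (𝒢.isotropy.mul b.toBundle α h) else 0, fun α h => dif_pos h⟩
    have h := β.integral_mul_left b.toBundle k hφ
    rw [b.r_toBundle, b.s_toBundle, ← β.integral_fiberMeasure, ← β.integral_fiberMeasure] at h
    simp only [hk, hg] at h
    rw [← h]
    refine integral_congr_ae (Filter.Eventually.of_forall fun a => ?_)
    change _ = φ a.toBundle
    rw [hφ a.toBundle (b.s_toBundle.trans a.r_toBundle.symm), ← IsotropyGroup.toBundle_mul, hk, hg]

instance (β : 𝒢.isotropy.HaarSystem) (u : X) : (β.fiberMeasure u).IsHaarMeasure where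

end HaarSystem

end TopologicalGroupoid

/-! ### Uniform estimates over nearby isotropy groups -/

namespace TopologicalGroupoid

variable {G X : Type*} [TopologicalSpace G] [TopologicalSpace X] {𝒢 : TopologicalGroupoid G X}

/-- The image of the trace of an open `U` is the set of `u` whose `A_u` meets `U`, the preimage of a
subbasic Fell open set. -/
theorem isOpenMap_isotropy_r [T2Space G] (varying : 𝒢.ContinuouslyVaryingIsotropy) :
    IsOpenMap 𝒢.isotropy.r := by
  intro O hO
  obtain ⟨U, hU, rfl⟩ := isOpen_induced_iff.1 hO
  have h : IsOpen[fellTopology G] {F : TopologicalSpace.Closeds G | ((F : Set G) ∩ U).Nonempty} :=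
    TopologicalSpace.isOpen_generateFrom_of_mem (Or.inr ⟨U, hU, rfl⟩)
  convert (continuous_def.1 varying) _ h using 1
  ext u
  constructor
  · rintro ⟨a, ha, rfl⟩
    exact ⟨a.1, ⟨rfl, a.2.symm⟩, ha⟩
  · rintro ⟨γ, ⟨hr, hs⟩, hγ⟩
    exact ⟨⟨γ, hr.trans hs.symm⟩, hγ, hr⟩

section Division

variable (𝒢) in
/-- Left division `(b, c) ↦ b⁻¹c` on the pairs of arrows with the same range. -/
def leftDiv (p : {p : G × G // 𝒢.r p.1 = 𝒢.r p.2}) : G :=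
  𝒢.mul (𝒢.inv p.1.1) p.1.2 ((𝒢.s_inv _).trans p.2)

theorem continuous_leftDiv : Continuous 𝒢.leftDiv :=
  𝒢.continuous_mul.comp (Continuous.subtype_mk
    (f := fun p : {p : G × G // 𝒢.r p.1 = 𝒢.r p.2} => (𝒢.inv p.1.1, p.1.2))
    ((𝒢.continuous_inv.comp (continuous_fst.comp continuous_subtype_val)).prodMk
      (continuous_snd.comp continuous_subtype_val)) (fun p => (𝒢.s_inv _).trans p.2))

theorem leftDiv_mul (γ η : G) (h : 𝒢.s γ = 𝒢.r η) (h' : 𝒢.r γ = 𝒢.r (𝒢.mul γ η h)) :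
    𝒢.leftDiv ⟨(γ, 𝒢.mul γ η h), h'⟩ = η := by
  change 𝒢.mul (𝒢.inv γ) (𝒢.mul γ η h) _ = η
  rw [← 𝒢.mul_assoc (𝒢.inv γ) γ η (𝒢.s_inv γ) h]
  simp only [𝒢.inv_mul, 𝒢.unit_mul]

theorem leftDiv_self (γ : G) : 𝒢.leftDiv ⟨(γ, γ), rfl⟩ = 𝒢.unit (𝒢.s γ) := 𝒢.inv_mul γ

/-- The compact set of all `c⁻¹d` with `c ∈ N` and `d ∈ K`. -/
theorem isCompact_leftDiv [T2Space G] {N K : Set G} (hN : IsCompact N) (hK : IsCompact K) :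
    IsCompact (𝒢.leftDiv '' (Subtype.val ⁻¹' (N ×ˢ K))) := by
  have := 𝒢.t2Space_units
  have hc : IsClosed {p : G × G | 𝒢.r p.1 = 𝒢.r p.2} :=
    isClosed_eq (𝒢.continuous_r.comp continuous_fst) (𝒢.continuous_r.comp continuous_snd)
  exact (hc.isClosedEmbedding_subtypeVal.isCompact_preimage (hN.prod hK)).image continuous_leftDiv

end Division

/-- A continuous function on pairs of arrows with the same range, which is compactly supported in
the second variable, is uniformly small near a point where it vanishes. -/
theorem eventually_forall_norm_lt [T2Space G] {c₀ : G} {N L : Set G} (hN : IsCompact N)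
    (hN₀ : N ∈ 𝓝 c₀) (hL : IsCompact L) {h : {p : G × G // 𝒢.r p.1 = 𝒢.r p.2} → ℝ}
    (hc : Continuous h) (hs : ∀ p, p.1.1 ∈ N → p.1.2 ∉ L → h p = 0)
    (h₀ : ∀ p, p.1.1 = c₀ → h p = 0) {ε : ℝ} (hε : 0 < ε) :
    ∀ᶠ c in 𝓝 c₀, ∀ a (H : 𝒢.r c = 𝒢.r a), ‖h ⟨(c, a), H⟩‖ < ε := by
  have := 𝒢.t2Space_units
  have hcl : IsClosed {p : G × G | 𝒢.r p.1 = 𝒢.r p.2} :=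
    isClosed_eq (𝒢.continuous_r.comp continuous_fst) (𝒢.continuous_r.comp continuous_snd)
  -- The pairs where `h` is large, with first entry in `N`, form a compact set. Its first projection
  -- is closed and misses `c₀`.
  have hS : IsCompact (Subtype.val ⁻¹' (N ×ˢ L) ∩ {p | ε ≤ ‖h p‖}) :=
    (hcl.isClosedEmbedding_subtypeVal.isCompact_preimage (hN.prod hL)).inter_right
      (isClosed_le continuous_const hc.norm)
  have hP := (hS.image (continuous_fst.comp continuous_subtype_val)).isClosed
  have hn : c₀ ∉ (Prod.fst ∘ Subtype.val) ''
      (Subtype.val ⁻¹' (N ×ˢ L) ∩ {p : {p : G × G // 𝒢.r p.1 = 𝒢.r p.2} | ε ≤ ‖h p‖}) := by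
    rintro ⟨p, ⟨-, hp⟩, rfl⟩
    have hp : ε ≤ ‖h p‖ := hp
    rw [h₀ p rfl, norm_zero] at hp
    exact hε.not_ge hp
  filter_upwards [hN₀, hP.isOpen_compl.mem_nhds hn] with c hcN hcP a H
  by_contra hlt
  rw [not_lt] at hlt
  refine hcP ⟨⟨(c, a), H⟩, ⟨⟨hcN, ?_⟩, hlt⟩, rfl⟩
  by_contra haL
  rw [hs ⟨(c, a), H⟩ hcN haL, norm_zero] at hlt
  exact hε.not_ge hlt

section Fibers

variable [MeasurableSpace G] [BorelSpace G] [T2Space G] [LocallyCompactSpace G]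
  (μ : ∀ u, Measure (𝒢.IsotropyGroup u)) [∀ u, (μ u).IsHaarMeasure]

/-- Induction over the compact set `K`. Around a point `a` over `u₀`, take `N` with `N⁻¹N ⊆ W`.
Openness of `r` puts some `b ∈ N` in every nearby fibre, whose part of `N` then lies in `bW`. Left
invariance gives the bound with constant 1, whatever the normalization of `μ u`. A point not over
`u₀` has a neighbourhood that nearby fibres avoid. -/
theorem measure_le_of_eventually (hr : IsOpenMap 𝒢.isotropy.r) {u₀ : X} {W : Set 𝒢.IsotropyBundle}
    (hW : W ∈ 𝓝 (𝒢.isotropy.unit u₀)) {K : Set 𝒢.IsotropyBundle} (hK : IsCompact K) :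
    ∃ C : NNReal, ∀ᶠ u in 𝓝 u₀,
      μ u (IsotropyGroup.toBundle ⁻¹' K) ≤ C * μ u (IsotropyGroup.toBundle ⁻¹' W) := by
  have := 𝒢.t2Space_units
  refine hK.induction_on (p := fun S => ∃ C : NNReal, ∀ᶠ u in 𝓝 u₀,
      μ u (IsotropyGroup.toBundle ⁻¹' S) ≤ C * μ u (IsotropyGroup.toBundle ⁻¹' W)) ?_ ?_ ?_ ?_
  · exact ⟨0, by simp⟩
  · rintro S T hST ⟨C, hC⟩
    refine ⟨C, ?_⟩
    filter_upwards [hC] with u hu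
    exact (measure_mono (Set.preimage_mono hST)).trans hu
  · rintro S T ⟨C, hC⟩ ⟨D, hD⟩
    refine ⟨C + D, ?_⟩
    filter_upwards [hC, hD] with u hu hu'
    rw [Set.preimage_union, ENNReal.coe_add, add_mul]
    exact (measure_union_le _ _).trans (add_le_add hu hu')
  · intro a _
    by_cases ha : 𝒢.isotropy.r a = u₀
    · have hd : 𝒢.isotropy.leftDiv ⁻¹' W ∈
          𝓝 (⟨(a, a), rfl⟩ : {p : 𝒢.IsotropyBundle × 𝒢.IsotropyBundle //
            𝒢.isotropy.r p.1 = 𝒢.isotropy.r p.2}) := by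
        refine continuous_leftDiv.continuousAt.preimage_mem_nhds ?_
        rw [leftDiv_self, show 𝒢.isotropy.s a = u₀ from a.2.symm.trans ha]
        exact hW
      rw [nhds_subtype_eq_comap, Filter.mem_comap] at hd
      obtain ⟨T, hT, hTW⟩ := hd
      rw [nhds_prod_eq, Filter.mem_prod_self_iff] at hT
      obtain ⟨N, hN, hNT⟩ := hT
      refine ⟨N, mem_nhdsWithin_of_mem_nhds hN, 1, ?_⟩
      have hu := hr.image_mem_nhds hN
      rw [ha] at hu
      filter_upwards [hu]
      rintro u ⟨b, hb, hbu⟩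
      let b' : 𝒢.IsotropyGroup u := ⟨b.1, hbu, b.2.symm.trans hbu⟩
      rw [ENNReal.coe_one, one_mul]
      refine (measure_mono fun c hc => ?_).trans_eq (measure_preimage_mul (μ u) b'⁻¹ _)
      exact hTW (a := ⟨(b, c.toBundle), hbu.trans c.r_toBundle.symm⟩) (hNT ⟨hb, hc⟩)
    · obtain ⟨U, V, hU, hV, haU, huV, hUV⟩ := t2_separation ha
      refine ⟨𝒢.isotropy.r ⁻¹' U, mem_nhdsWithin_of_mem_nhds
        ((hU.preimage 𝒢.isotropy.continuous_r).mem_nhds haU), 0, ?_⟩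
      filter_upwards [hV.mem_nhds huV] with u hu
      rw [ENNReal.coe_zero, zero_mul, nonpos_iff_eq_zero]
      convert measure_empty (μ := μ u)
      rw [Set.eq_empty_iff_forall_notMem]
      intro c hc
      refine Set.disjoint_left.1 hUV ?_ hu
      rw [← c.r_toBundle]
      exact hc

/-- The integral of a function on the isotropy groupoid over an isotropy group. -/
noncomputable def fiberIntegral (u : X) (f : CompactlySupportedContinuousMap 𝒢.IsotropyBundle ℝ) :
    ℝ := ∫ a, f a.toBundle ∂(μ u)

variable {μ}

theorem fiberIntegrable (u : X) (f : CompactlySupportedContinuousMap 𝒢.IsotropyBundle ℝ) :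
    Integrable (fun a => f a.toBundle) (μ u) :=
  (f.continuous.comp IsotropyGroup.continuous_toBundle).integrable_of_hasCompactSupport
    (f.hasCompactSupport.comp_isClosedEmbedding IsotropyGroup.isClosedEmbedding_toBundle)

theorem fiberIntegral_add (u : X) (f g : CompactlySupportedContinuousMap 𝒢.IsotropyBundle ℝ) :
    fiberIntegral μ u (f + g) = fiberIntegral μ u f + fiberIntegral μ u g :=
  integral_add (fiberIntegrable u f) (fiberIntegrable u g)

theorem fiberIntegral_smul (u : X) (c : ℝ)
    (f : CompactlySupportedContinuousMap 𝒢.IsotropyBundle ℝ) :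
    fiberIntegral μ u (c • f) = c * fiberIntegral μ u f :=
  integral_const_mul c _

theorem fiberIntegral_nonneg (u : X) {f : CompactlySupportedContinuousMap 𝒢.IsotropyBundle ℝ}
    (hf : ∀ a, 0 ≤ f a) : 0 ≤ fiberIntegral μ u f :=
  integral_nonneg fun _ => hf _

theorem fiberIntegral_pos {u : X} {f : CompactlySupportedContinuousMap 𝒢.IsotropyBundle ℝ}
    (hf : ∀ a, 0 ≤ f a) (hu : 0 < f (𝒢.isotropy.unit u)) : 0 < fiberIntegral μ u f := by
  rw [fiberIntegral, integral_pos_iff_support_of_nonneg (fun a => hf _) (fiberIntegrable u f)]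
  exact ((f.continuous.comp IsotropyGroup.continuous_toBundle).isOpen_support).measure_pos _
    ⟨1, hu.ne'⟩

/-- `F` serves as local normalization: it is at least `δ` near the unit, so Markov's inequality and
the previous comparison bound the measure of `K` by a multiple of the integral of `F`, uniformly in
`u`. -/
theorem norm_integral_le_of_eventually (hr : IsOpenMap 𝒢.isotropy.r) {u₀ : X}
    {F : CompactlySupportedContinuousMap 𝒢.IsotropyBundle ℝ} (hF : ∀ a, 0 ≤ F a)
    (hu₀ : 0 < F (𝒢.isotropy.unit u₀)) {K : Set 𝒢.IsotropyBundle} (hK : IsCompact K) :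
    ∃ C : ℝ, 0 ≤ C ∧ ∀ᶠ u in 𝓝 u₀, ∀ (ε : ℝ) (h : 𝒢.IsotropyGroup u → ℝ), (∀ a, ‖h a‖ ≤ ε) →
      (∀ a, a.toBundle ∉ K → h a = 0) → ‖∫ a, h a ∂(μ u)‖ ≤ ε * (C * fiberIntegral μ u F) := by
  set δ := F (𝒢.isotropy.unit u₀) / 2 with hδ
  have hδ0 : 0 < δ := half_pos hu₀
  have hW : {a | δ ≤ F a} ∈ 𝓝 (𝒢.isotropy.unit u₀) :=
    F.continuous.continuousAt.eventually (le_mem_nhds (half_lt_self hu₀))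
  obtain ⟨C, hC⟩ := measure_le_of_eventually μ hr hW hK
  refine ⟨C * δ⁻¹, by positivity, ?_⟩
  filter_upwards [hC] with u hu ε h hε hK0
  have hm := mul_meas_ge_le_integral_of_nonneg
    (Filter.Eventually.of_forall fun a : 𝒢.IsotropyGroup u => hF a.toBundle)
    (fiberIntegrable (μ := μ) u F) δ
  have hKc : IsCompact (IsotropyGroup.toBundle (u := u) ⁻¹' K) :=
    IsotropyGroup.isClosedEmbedding_toBundle.isCompact_preimage hK
  have hWc : IsCompact (IsotropyGroup.toBundle (u := u) ⁻¹' {a | δ ≤ F a}) := by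
    refine IsotropyGroup.isClosedEmbedding_toBundle.isCompact_preimage
      (F.hasCompactSupport.isCompact.of_isClosed_subset
        (isClosed_le continuous_const F.continuous) fun a ha => subset_tsupport _ ?_)
    exact (hδ0.trans_le ha).ne'
  have h1 : (μ u).real (IsotropyGroup.toBundle ⁻¹' K) ≤
      C * (μ u).real (IsotropyGroup.toBundle ⁻¹' {a | δ ≤ F a}) := by
    have := ENNReal.toReal_mono (ENNReal.mul_ne_top ENNReal.coe_ne_top hWc.measure_lt_top.ne) hu
    rwa [ENNReal.toReal_mul] at this
  have h2 : (μ u).real (IsotropyGroup.toBundle ⁻¹' {a | δ ≤ F a}) ≤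
      δ⁻¹ * fiberIntegral μ u F := by
    rw [← div_eq_inv_mul, le_div_iff₀' hδ0]
    exact hm
  have h3 : ∫ a, h a ∂(μ u) = ∫ a in IsotropyGroup.toBundle ⁻¹' K, h a ∂(μ u) :=
    (setIntegral_eq_integral_of_forall_compl_eq_zero fun a ha => hK0 a ha).symm
  have hε0 : 0 ≤ ε := (norm_nonneg _).trans (hε 1)
  rw [h3]
  refine (norm_setIntegral_le_of_norm_le_const hKc.measure_lt_top fun a _ => hε a).trans ?_
  gcongr
  refine h1.trans ?_
  rw [_root_.mul_assoc]
  gcongr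

/-- The integral of a translate over nearby isotropy groups. -/
theorem tendsto_fiberIntegral_sub (hr : IsOpenMap 𝒢.isotropy.r) {u₀ : X}
    {F : CompactlySupportedContinuousMap 𝒢.IsotropyBundle ℝ} (hF : ∀ a, 0 ≤ F a)
    (hu₀ : 0 < F (𝒢.isotropy.unit u₀)) (b : 𝒢.IsotropyGroup u₀)
    {f g : CompactlySupportedContinuousMap 𝒢.IsotropyBundle ℝ}
    (hfg : ∀ a : 𝒢.IsotropyGroup u₀, f (b * a).toBundle = g a.toBundle) :
    Filter.Tendsto (fun u => fiberIntegral μ u f / fiberIntegral μ u F -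
      fiberIntegral μ u g / fiberIntegral μ u F) (𝓝 u₀) (𝓝 0) := by
  obtain ⟨N, hN, hNb⟩ := exists_compact_mem_nhds b.toBundle
  -- If `c ∈ N` and `f(ca) ≠ 0`, then `a = c⁻¹(ca)` lies in the second set. So `L` carries `a ↦
  -- f(ca) - g(a)` for all `c ∈ N` at once.
  set L := tsupport g ∪ 𝒢.isotropy.leftDiv '' (Subtype.val ⁻¹' (N ×ˢ tsupport f)) with hL
  have hLc : IsCompact L := g.hasCompactSupport.isCompact.union
    (isCompact_leftDiv hN f.hasCompactSupport)
  obtain ⟨C, hC0, hC⟩ := norm_integral_le_of_eventually (μ := μ) hr hF hu₀ hLc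
  have hpos : ∀ᶠ u in 𝓝 u₀, 0 < fiberIntegral μ u F := by
    filter_upwards [(F.continuous.comp 𝒢.isotropy.continuous_unit).continuousAt.eventually
      (lt_mem_nhds hu₀)] with u hu
    exact fiberIntegral_pos hF hu
  let h : {p : 𝒢.IsotropyBundle × 𝒢.IsotropyBundle // 𝒢.isotropy.r p.1 = 𝒢.isotropy.r p.2} → ℝ :=
    fun p => f (𝒢.isotropy.mul p.1.1 p.1.2 (p.1.1.2.symm.trans p.2)) - g p.1.2
  have hc : Continuous h := by
    refine (f.continuous.comp (𝒢.isotropy.continuous_mul.comp (Continuous.subtype_mk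
      continuous_subtype_val (fun p => p.1.1.2.symm.trans p.2)))).sub
      (g.continuous.comp (continuous_snd.comp continuous_subtype_val))
  have hs : ∀ p, p.1.1 ∈ N → p.1.2 ∉ L → h p = 0 := by
    rintro ⟨⟨c, a⟩, hca⟩ hcN haL
    have hg : g a = 0 := image_eq_zero_of_notMem_tsupport fun h => haL (Or.inl h)
    have hf : f (𝒢.isotropy.mul c a (c.2.symm.trans hca)) = 0 := by
      refine image_eq_zero_of_notMem_tsupport fun h => haL (Or.inr ?_)
      exact ⟨⟨(c, 𝒢.isotropy.mul c a (c.2.symm.trans hca)), (𝒢.isotropy.r_mul _ _ _).symm⟩,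
        ⟨hcN, h⟩, leftDiv_mul _ _ _ _⟩
    change f (𝒢.isotropy.mul c a _) - g a = 0
    rw [hf, hg, sub_zero]
  have h₀ : ∀ p, p.1.1 = b.toBundle → h p = 0 := by
    rintro ⟨⟨c, a⟩, hca⟩ rfl
    have ha : 𝒢.isotropy.r a = u₀ := hca.symm.trans b.r_toBundle
    exact sub_eq_zero.2 (hfg ⟨a.1, ha, a.2.symm.trans ha⟩)
  rw [Metric.tendsto_nhds]
  intro ε hε
  -- `C` may be zero, hence `C + 1`.
  have hε' : 0 < ε / (C + 1) := by positivity
  have hrb : Filter.Tendsto 𝒢.isotropy.r (𝓝 b.toBundle) (𝓝 u₀) := by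
    have := 𝒢.isotropy.continuous_r.tendsto b.toBundle
    rwa [b.r_toBundle] at this
  -- The element `b` has no canonical counterpart in a nearby group, so the estimate is proved for
  -- arrows `c` near `b`, using translation by `c` in its own group. Openness of `r` then turns it
  -- into a statement about units near `u₀`.
  have key : ∀ᶠ c in 𝓝 b.toBundle, dist (fiberIntegral μ (𝒢.isotropy.r c) f /
      fiberIntegral μ (𝒢.isotropy.r c) F - fiberIntegral μ (𝒢.isotropy.r c) g /
      fiberIntegral μ (𝒢.isotropy.r c) F) 0 < ε := by
    filter_upwards [eventually_forall_norm_lt hN hNb hLc hc hs h₀ hε', hrb.eventually hC,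
      hrb.eventually hpos, hNb] with c h1 h2 h3 hcN
    let c' : 𝒢.IsotropyGroup (𝒢.isotropy.r c) := ⟨c.1, rfl, c.2.symm⟩
    have hd : fiberIntegral μ (𝒢.isotropy.r c) f - fiberIntegral μ (𝒢.isotropy.r c) g =
        ∫ a, (f (c' * a).toBundle - g a.toBundle) ∂(μ (𝒢.isotropy.r c)) := by
      have hi := (fiberIntegrable (μ := μ) (𝒢.isotropy.r c) f).comp_mul_left c'
      rw [integral_sub hi (fiberIntegrable _ g),
        integral_mul_left_eq_self (fun a => f (IsotropyGroup.toBundle a))]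
      rfl
    rw [← sub_div, hd, dist_zero_right, norm_div, Real.norm_of_nonneg h3.le, div_lt_iff₀ h3]
    refine (h2 (ε / (C + 1)) _ (fun a => (h1 a.toBundle a.r_toBundle.symm).le)
      (fun a ha => hs ⟨(c, a.toBundle), a.r_toBundle.symm⟩ hcN ha)).trans_lt ?_
    rw [← _root_.mul_assoc]
    refine mul_lt_mul_of_pos_right ?_ h3
    rw [div_mul_eq_mul_div, div_lt_iff₀ (by positivity)]
    linarith
  have h := hr.nhds_le b.toBundle
  rw [b.r_toBundle] at h
  exact h key

end Fibers

end TopologicalGroupoid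

/-! ### Uniqueness of Haar measure and continuity of ratios -/

namespace TopologicalGroupoid

variable {G X : Type*} [TopologicalSpace G] [TopologicalSpace X] {𝒢 : TopologicalGroupoid G X}

variable [MeasurableSpace G] [BorelSpace G] [T2Space G] [LocallyCompactSpace G]
  [SecondCountableTopology G]

theorem IsotropyGroup.one_mul_toBundle {u : X} (a : 𝒢.IsotropyGroup u) :
    (1 * a).toBundle = a.toBundle := by rw [one_mul]

/-- A positive functional on the functions on the isotropy groupoid which depends only on the
values on one isotropy group and is left invariant is a multiple of the Haar integral. -/
theorem exists_eq_mul_integral {u : X} (μ : Measure (𝒢.IsotropyGroup u)) [μ.IsHaarMeasure]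
    (Λ : CompactlySupportedContinuousMap 𝒢.IsotropyBundle ℝ →ₚ[ℝ] ℝ)
    (hΛ : ∀ (b : 𝒢.IsotropyGroup u) (f g : CompactlySupportedContinuousMap 𝒢.IsotropyBundle ℝ),
      (∀ a : 𝒢.IsotropyGroup u, f (b * a).toBundle = g a.toBundle) → Λ f = Λ g) :
    ∃ c : ℝ, ∀ f, Λ f = c * ∫ a, f a.toBundle ∂μ := by
  have := 𝒢.t2Space_units
  set ν := RealRMK.rieszMeasure Λ with hν
  have hνf : ∀ f : CompactlySupportedContinuousMap 𝒢.IsotropyBundle ℝ, ∫ a, f a ∂ν = Λ f :=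
    fun f => RealRMK.integral_rieszMeasure Λ f
  have hcl : IsClosed (𝒢.isotropy.r ⁻¹' {u}) :=
    isClosed_singleton.preimage 𝒢.isotropy.continuous_r
  -- The Riesz measure lives on the fibre: a compact set off the fibre is dominated by a function
  -- vanishing on the fibre, on which `Λ` is zero by the hypothesis with `b = 1`.
  have hν0 : ν (𝒢.isotropy.r ⁻¹' {u})ᶜ = 0 := by
    rw [hcl.isOpen_compl.measure_eq_iSup_isCompact]
    simp only [ENNReal.iSup_eq_zero]
    intro K hKu hK
    obtain ⟨f, h1, h0, hc, h01⟩ := exists_continuous_one_zero_of_isCompact hK hcl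
      (Set.disjoint_left.2 hKu)
    rw [← nonpos_iff_eq_zero]
    refine (RealRMK.rieszMeasure_le_of_eq_one Λ (f := ⟨f, hc⟩) (fun x => (h01 x).1) hK
      fun x hx => h1 hx).trans ?_
    rw [hΛ 1 ⟨f, hc⟩ 0 fun a => ?_]
    · simp
    · rw [IsotropyGroup.one_mul_toBundle]
      exact h0 a.r_toBundle
  have hint : ∀ f : CompactlySupportedContinuousMap 𝒢.IsotropyBundle ℝ,
      ∫ a : 𝒢.IsotropyGroup u, f a.toBundle ∂(ν.comap IsotropyGroup.toBundle) = Λ f := fun f =>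
    (IsotropyGroup.integral_comap_toBundle hν0 f).trans (hνf f)
  have : IsFiniteMeasureOnCompacts (ν.comap (IsotropyGroup.toBundle (u := u))) := ⟨fun K hK => by
    rw [IsotropyGroup.measurableEmbedding_toBundle.comap_apply]
    exact (hK.image IsotropyGroup.continuous_toBundle).measure_lt_top⟩
  have : (ν.comap (IsotropyGroup.toBundle (u := u))).IsMulLeftInvariant := ⟨fun b => by
    have hc : Continuous fun a => b * a := continuous_const_mul b
    have : IsFiniteMeasureOnCompacts
        ((ν.comap (IsotropyGroup.toBundle (u := u))).map (b * ·)) :=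
      Measure.IsFiniteMeasureOnCompacts.map _ (Homeomorph.mulLeft b)
    refine Measure.ext_of_integral_eq_on_compactlySupported fun f => ?_
    rw [integral_map hc.aemeasurable (map_continuous f).aestronglyMeasurable]
    obtain ⟨g, hg⟩ := IsotropyGroup.exists_restrict_eq f
    obtain ⟨g', hg'⟩ := IsotropyGroup.exists_restrict_eq
      (⟨⟨fun a => f (b * a), (map_continuous f).comp hc⟩,
        f.hasCompactSupport.comp_homeomorph (Homeomorph.mulLeft b)⟩ :
        CompactlySupportedContinuousMap (𝒢.IsotropyGroup u) ℝ)
    have h1 : Λ g = Λ g' := hΛ b g g' fun a => (hg _).trans (hg' a).symm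
    rw [← hint, ← hint] at h1
    simp only [hg, hg'] at h1
    exact h1.symm⟩
  refine ⟨Measure.haarScalarFactor (ν.comap IsotropyGroup.toBundle) μ, fun f => ?_⟩
  rw [← hint, ← smul_eq_mul, ← NNReal.smul_def, ← integral_smul_nnreal_measure,
    ← Measure.isMulLeftInvariant_eq_smul]

/-- Ratios of Haar integrals over the isotropy groups are continuous. -/
theorem tendsto_fiberIntegral_div (μ : ∀ u, Measure (𝒢.IsotropyGroup u))
    [∀ u, (μ u).IsHaarMeasure] (hr : IsOpenMap 𝒢.isotropy.r) {u₀ : X}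
    {F : CompactlySupportedContinuousMap 𝒢.IsotropyBundle ℝ} (hF : ∀ a, 0 ≤ F a)
    (hu₀ : 0 < F (𝒢.isotropy.unit u₀))
    (f : CompactlySupportedContinuousMap 𝒢.IsotropyBundle ℝ) :
    Filter.Tendsto (fun u => fiberIntegral μ u f / fiberIntegral μ u F) (𝓝 u₀)
      (𝓝 (fiberIntegral μ u₀ f / fiberIntegral μ u₀ F)) := by
  have hpos : ∀ᶠ u in 𝓝 u₀, 0 < fiberIntegral μ u F := by
    filter_upwards [(F.continuous.comp 𝒢.isotropy.continuous_unit).continuousAt.eventually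
      (lt_mem_nhds hu₀)] with u hu
    exact fiberIntegral_pos hF hu
  -- Along an ultrafilter the bounded ratios converge for all `f` simultaneously, and the limit is a
  -- positive linear functional of `f`.
  rw [Filter.tendsto_iff_ultrafilter]
  intro 𝒰 h𝒰
  have hex : ∀ f : CompactlySupportedContinuousMap 𝒢.IsotropyBundle ℝ, ∃ l,
      Filter.Tendsto (fun u => fiberIntegral μ u f / fiberIntegral μ u F) 𝒰 (𝓝 l) := by
    intro f
    obtain ⟨C, hC0, hC⟩ := norm_integral_le_of_eventually (μ := μ) hr hF hu₀
      f.hasCompactSupport.isCompact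
    obtain ⟨M, hM⟩ := f.hasCompactSupport.exists_bound_of_continuous f.continuous
    have hb : ∀ᶠ u in 𝓝 u₀, fiberIntegral μ u f / fiberIntegral μ u F ∈
        Metric.closedBall (0 : ℝ) (M * C) := by
      filter_upwards [hC, hpos] with u h1 h2
      rw [mem_closedBall_zero_iff, norm_div, Real.norm_of_nonneg h2.le, div_le_iff₀ h2,
        _root_.mul_assoc]
      exact h1 M _ (fun a => hM _) fun a ha => image_eq_zero_of_notMem_tsupport ha
    obtain ⟨l, -, hl⟩ := (isCompact_closedBall (0 : ℝ) (M * C)).ultrafilter_le_nhds'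
      (𝒰.map fun u => fiberIntegral μ u f / fiberIntegral μ u F) (h𝒰 hb)
    exact ⟨l, hl⟩
  choose Λ hΛ using hex
  let Λ' : CompactlySupportedContinuousMap 𝒢.IsotropyBundle ℝ →ₗ[ℝ] ℝ :=
    { toFun := Λ
      map_add' := fun f g => tendsto_nhds_unique (hΛ (f + g)) (by
        simpa only [fiberIntegral_add, add_div] using (hΛ f).add (hΛ g))
      map_smul' := fun c f => tendsto_nhds_unique (hΛ (c • f)) (by
        simpa only [fiberIntegral_smul, mul_div_assoc, RingHom.id_apply, smul_eq_mul] using (hΛ f).const_mul c) }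
  have hpos' : ∀ f, 0 ≤ f → 0 ≤ Λ' f := fun f hf => ge_of_tendsto' (hΛ f) fun u =>
    div_nonneg (fiberIntegral_nonneg u fun a => hf a) (fiberIntegral_nonneg u hF)
  obtain ⟨c, hc⟩ := exists_eq_mul_integral (μ u₀) (PositiveLinearMap.mk₀ Λ' hpos') (by
    intro b f g hfg
    have h1 := (hΛ f).sub (hΛ g)
    exact sub_eq_zero.1 (tendsto_nhds_unique h1
      ((tendsto_fiberIntegral_sub hr hF hu₀ b hfg).mono_left h𝒰)))
  have hc : ∀ f, Λ f = c * fiberIntegral μ u₀ f := hc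
  -- The value at `F` fixes the multiple of the Haar integral, so the limit does not depend on the
  -- ultrafilter.
  have hF1 : Λ F = 1 := by
    refine tendsto_nhds_unique (hΛ F) (tendsto_const_nhds.congr' ?_)
    filter_upwards [h𝒰 hpos] with u hu
    exact (div_self hu.ne').symm
  have hcF := hc F
  rw [hF1] at hcF
  have h0 := hpos.self_of_nhds
  have : Λ f = fiberIntegral μ u₀ f / fiberIntegral μ u₀ F := by
    rw [hc f, eq_div_iff h0.ne', mul_right_comm, ← hcF, one_mul]
  rw [← this]
  exact hΛ f

end TopologicalGroupoid

/-! ### Existence of a Haar system on the isotropy groupoid -/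

namespace TopologicalGroupoid

variable {G X : Type*} [TopologicalSpace G] [TopologicalSpace X] {𝒢 : TopologicalGroupoid G X}

variable [MeasurableSpace G] [BorelSpace G] [T2Space G] [LocallyCompactSpace G]
  [SecondCountableTopology G]

/-- Haar measures on the isotropy groups can be rescaled so as to vary continuously. -/
theorem exists_continuous_smul_fiberIntegral (μ : ∀ u, Measure (𝒢.IsotropyGroup u))
    [∀ u, (μ u).IsHaarMeasure] (hr : IsOpenMap 𝒢.isotropy.r) :
    ∃ c : X → ℝ, (∀ u, 0 < c u) ∧ ∀ f, Continuous fun u => c u * fiberIntegral μ u f := by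
  have := 𝒢.t2Space_units
  have := 𝒢.locallyCompactSpace_units
  have := 𝒢.secondCountableTopology_units
  -- A normalization at `u` is a point of the ray of positive multiples of the Haar integral, inside
  -- the space of all functionals with pointwise convergence. A continuous selection from these
  -- convex sets is glued from local ones.
  let t : X → Set (CompactlySupportedContinuousMap 𝒢.IsotropyBundle ℝ → ℝ) := fun u =>
    {e | ∃ c : ℝ, 0 < c ∧ ∀ f, e f = c * fiberIntegral μ u f}
  have ht : ∀ u, Convex ℝ (t u) := by
    rintro u e ⟨c, hc, he⟩ e' ⟨c', hc', he'⟩ p q hp hq hpq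
    refine ⟨p * c + q * c', ?_, fun f => ?_⟩
    · rcases hp.eq_or_lt with rfl | hp
      · rw [zero_add] at hpq
        simpa [hpq] using hc'
      · positivity
    · simp only [Pi.add_apply, Pi.smul_apply, smul_eq_mul, he, he']
      ring
  obtain ⟨g, hg⟩ := exists_continuous_forall_mem_convex_of_local ht fun u₀ => by
    obtain ⟨F, hF1, hF, -⟩ := CompactlySupportedContinuousMap.exists_bump
      (Filter.univ_mem : Set.univ ∈ 𝓝 (𝒢.isotropy.unit u₀))
    refine ⟨{u | 0 < F (𝒢.isotropy.unit u)},
      (F.continuous.comp 𝒢.isotropy.continuous_unit).continuousAt.eventually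
        (lt_mem_nhds (by simp [hF1])),
      fun u f => fiberIntegral μ u f / fiberIntegral μ u F, ?_, ?_⟩
    · intro u hu
      exact ContinuousAt.continuousWithinAt (tendsto_pi_nhds.2 fun f =>
        tendsto_fiberIntegral_div μ hr hF hu f)
    · intro u hu
      exact ⟨(fiberIntegral μ u F)⁻¹, inv_pos.2 (fiberIntegral_pos hF hu), fun f =>
        div_eq_inv_mul _ _⟩
  choose c hc hgc using hg
  refine ⟨c, hc, fun f => ?_⟩
  simp only [← hgc]
  exact (continuous_apply f).comp g.continuous

theorem nonempty_isotropy_haarSystem (varying : 𝒢.ContinuouslyVaryingIsotropy) :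
    Nonempty 𝒢.isotropy.HaarSystem := by
  have := 𝒢.t2Space_units
  obtain ⟨μ, hμ⟩ : ∃ μ : ∀ u, Measure (𝒢.IsotropyGroup u), ∀ u, (μ u).IsHaarMeasure :=
    ⟨fun u => Measure.haar, fun u => inferInstance⟩
  obtain ⟨c, hc, hcont⟩ := exists_continuous_smul_fiberIntegral μ
    (isOpenMap_isotropy_r varying)
  let m : X → Measure 𝒢.IsotropyBundle := fun u =>
    ENNReal.ofReal (c u) • (μ u).map IsotropyGroup.toBundle
  have hint : ∀ {E : Type} [NormedAddCommGroup E] [NormedSpace ℝ E] (u : X)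
      (f : 𝒢.IsotropyBundle → E), ∫ a, f a ∂(m u) = c u • ∫ a, f a.toBundle ∂(μ u) := by
    intro E _ _ u f
    rw [integral_smul_measure, IsotropyGroup.measurableEmbedding_toBundle.integral_map,
      ENNReal.toReal_ofReal (hc u).le]
  have hm0 : ∀ u, m u (𝒢.isotropy.r ⁻¹' {u})ᶜ = 0 := by
    intro u
    rw [Measure.smul_apply, IsotropyGroup.measurableEmbedding_toBundle.map_apply,
      ← IsotropyGroup.range_toBundle]
    simp
  have hK : ∀ u, IsFiniteMeasureOnCompacts (m u) := fun u => ⟨fun K hK => by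
    rw [Measure.smul_apply, IsotropyGroup.measurableEmbedding_toBundle.map_apply, smul_eq_mul]
    exact ENNReal.mul_lt_top ENNReal.ofReal_lt_top
      (IsotropyGroup.isClosedEmbedding_toBundle.isCompact_preimage hK).measure_lt_top⟩
  have hreg : ∀ u, (m u).Regular := fun u => inferInstance
  refine ⟨⟨m, hreg, fun u => ?_, fun f => ?_, fun γ f => ?_⟩⟩
  · refine Set.Subset.antisymm (Measure.support_subset_of_isClosed
      (isClosed_singleton.preimage 𝒢.isotropy.continuous_r) (hm0 u)) fun a ha => ?_
    rw [Measure.mem_support_iff_forall]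
    intro U hU
    rw [Measure.smul_apply, IsotropyGroup.measurableEmbedding_toBundle.map_apply, smul_eq_mul]
    let a' : 𝒢.IsotropyGroup u := ⟨a.1, ha, a.2.symm.trans ha⟩
    have hU' : IsotropyGroup.toBundle ⁻¹' U ∈ 𝓝 a' :=
      IsotropyGroup.continuous_toBundle.continuousAt.preimage_mem_nhds hU
    exact ENNReal.mul_pos (ENNReal.ofReal_pos.2 (hc u)).ne' (Measure.measure_pos_of_mem_nhds _ hU').ne'
  · let re : CompactlySupportedContinuousMap 𝒢.IsotropyBundle ℝ :=
      ⟨⟨fun a => (f a).re, Complex.continuous_re.comp f.continuous⟩,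
        f.hasCompactSupport.comp_left Complex.zero_re⟩
    let im : CompactlySupportedContinuousMap 𝒢.IsotropyBundle ℝ :=
      ⟨⟨fun a => (f a).im, Complex.continuous_im.comp f.continuous⟩,
        f.hasCompactSupport.comp_left Complex.zero_im⟩
    have he : ∀ u, ∫ a, f a ∂(m u) = ((c u * fiberIntegral μ u re : ℝ) : ℂ) +
        ((c u * fiberIntegral μ u im : ℝ) : ℂ) * Complex.I := by
      intro u
      have h1 : ∀ g : CompactlySupportedContinuousMap 𝒢.IsotropyBundle ℝ,
          c u * fiberIntegral μ u g = ∫ a, g a ∂(m u) := fun g => (hint u g).symm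
      rw [h1, h1]
      exact (integral_re_add_im (𝕜 := ℂ)
        (f.continuous.integrable_of_hasCompactSupport f.hasCompactSupport)).symm
    simp only [he]
    exact (Complex.continuous_ofReal.comp (hcont re)).add
      ((Complex.continuous_ofReal.comp (hcont im)).mul continuous_const)
  · classical
    have hS : MeasurableSet {α : 𝒢.IsotropyBundle | 𝒢.isotropy.s γ = 𝒢.isotropy.r α} :=
      (isClosed_eq continuous_const 𝒢.isotropy.continuous_r).measurableSet
    obtain ⟨φ, hφ⟩ : ∃ φ : 𝒢.IsotropyBundle → ℂ,
        ∀ α h, φ α = f (𝒢.isotropy.mul γ α h) :=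
      ⟨fun α => if h : _ then f (𝒢.isotropy.mul γ α h) else 0, fun α h => dif_pos h⟩
    have h1 : (m (𝒢.isotropy.s γ)).restrict
        {α : 𝒢.IsotropyBundle | 𝒢.isotropy.s γ = 𝒢.isotropy.r α} = m (𝒢.isotropy.s γ) := by
      refine Measure.restrict_eq_self_of_ae_mem ?_
      filter_upwards [show (𝒢.isotropy.r ⁻¹' {𝒢.isotropy.s γ}) ∈ ae (m (𝒢.isotropy.s γ)) from
        hm0 _] with α hα using (Set.mem_singleton_iff.1 hα).symm
    have h2 : ∫ α : {α // 𝒢.isotropy.s γ = 𝒢.isotropy.r α}, f (𝒢.isotropy.mul γ α.1 α.2)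
        ∂((m (𝒢.isotropy.s γ)).comap Subtype.val) = ∫ α, φ α ∂(m (𝒢.isotropy.s γ)) := by
      conv_rhs => rw [← h1, ← integral_subtype_comap hS]
      exact integral_congr_ae (Filter.Eventually.of_forall fun α => (hφ _ _).symm)
    rw [h2, show 𝒢.isotropy.s γ = 𝒢.isotropy.r γ from γ.2.symm, hint, hint]
    congr 1
    let b : 𝒢.IsotropyGroup (𝒢.isotropy.r γ) := ⟨γ.1, rfl, γ.2.symm⟩
    rw [← integral_mul_left_eq_self (fun a => f (IsotropyGroup.toBundle a)) b]
    refine integral_congr_ae (Filter.Eventually.of_forall fun a => ?_)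
    exact hφ a.toBundle (γ.2.symm.trans a.r_toBundle.symm)

end TopologicalGroupoid

/-! ### Topology of the dual of the isotropy groupoid -/

namespace TopologicalGroupoid

variable {G X : Type*} [TopologicalSpace G] [TopologicalSpace X] {𝒢 : TopologicalGroupoid G X}

variable [MeasurableSpace G] [BorelSpace G] [T2Space G] [LocallyCompactSpace G]
  [SecondCountableTopology G] {β : 𝒢.isotropy.HaarSystem}

theorem HaarSystem.integrable_mul (β : 𝒢.isotropy.HaarSystem) {u : X}
    {h : 𝒢.IsotropyGroup u → ℂ} (hc : Continuous h)
    (f : CompactlySupportedContinuousMap 𝒢.IsotropyBundle ℂ) :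
    Integrable (fun a => h a * f a.toBundle) (β.fiberMeasure u) :=
  (hc.mul (f.continuous.comp IsotropyGroup.continuous_toBundle)).integrable_of_hasCompactSupport
    (f.hasCompactSupport.comp_isClosedEmbedding IsotropyGroup.isClosedEmbedding_toBundle).mul_left

/-- Put `g = Re(w h)` with `w` the conjugate of `h a₀`, and test against `g k` for a bump `k` at
`a₀`. The real part of `w` times the integral is `∫ g² k > 0`. -/
theorem HaarSystem.exists_integral_mul_ne_zero (β : 𝒢.isotropy.HaarSystem) {u : X}
    {h : 𝒢.IsotropyGroup u → ℂ} (hc : Continuous h) {a₀ : 𝒢.IsotropyGroup u} (ha₀ : h a₀ ≠ 0) :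
    ∃ f : CompactlySupportedContinuousMap 𝒢.IsotropyBundle ℂ,
      ∫ a, h a * f a.toBundle ∂(β.fiberMeasure u) ≠ 0 := by
  let w := (starRingEnd ℂ) (h a₀)
  let g : 𝒢.IsotropyGroup u → ℝ := fun a => (w * h a).re
  have hg : Continuous g := Complex.continuous_re.comp (continuous_const.mul hc)
  have hg₀ : g a₀ ≠ 0 := by
    change (w * h a₀).re ≠ 0
    rw [mul_comm, Complex.mul_conj, Complex.ofReal_re]
    exact (Complex.normSq_pos.2 ha₀).ne'
  obtain ⟨k, hk1, hk, -⟩ := CompactlySupportedContinuousMap.exists_bump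
    (Filter.univ_mem : Set.univ ∈ 𝓝 a₀)
  obtain ⟨f, hf⟩ := IsotropyGroup.exists_restrict_eq
    (⟨⟨fun a => g a * k a, hg.mul (map_continuous k)⟩, k.hasCompactSupport.mul_left⟩ :
      CompactlySupportedContinuousMap (𝒢.IsotropyGroup u) ℝ)
  obtain ⟨F, hF⟩ := f.exists_ofReal
  refine ⟨F, fun h0 => ?_⟩
  have h1 : ∫ a, (w * h a) * F a.toBundle ∂(β.fiberMeasure u) = 0 := by
    simp only [_root_.mul_assoc]
    rw [integral_const_mul, h0, mul_zero]
  have h2 : ∫ a, g a * (g a * k a) ∂(β.fiberMeasure u) = 0 := by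
    have h3 := integral_re (β.integrable_mul (continuous_const.mul hc) F)
      (f := fun a => (w * h a) * F a.toBundle)
    rw [h1, map_zero] at h3
    rw [← h3]
    refine integral_congr_ae (Filter.Eventually.of_forall fun a => ?_)
    change g a * (g a * k a) = ((w * h a) * F a.toBundle).re
    rw [hF, hf, Complex.re_mul_ofReal]
    rfl
  have h4 : 0 < ∫ a, g a * (g a * k a) ∂(β.fiberMeasure u) := by
    have hcont : Continuous fun a => g a * (g a * k a) := hg.mul (hg.mul (map_continuous k))
    refine hcont.integral_pos_of_hasCompactSupport_nonneg_nonzero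
      (k.hasCompactSupport.mul_left.mul_left) (fun a => ?_) (x := a₀) ?_
    · change 0 ≤ g a * (g a * k a)
      rw [← _root_.mul_assoc]
      exact mul_nonneg (mul_self_nonneg _) (hk a)
    · simp [hk1, hg₀]
  exact h4.ne' h2

/-- Multiplication of a function on the isotropy groupoid by a function on the units. -/
noncomputable def mulBase (φ : C(X, ℝ)) (f : CompactlySupportedContinuousMap 𝒢.IsotropyBundle ℂ) :
    CompactlySupportedContinuousMap 𝒢.IsotropyBundle ℂ :=
  ⟨⟨fun a => (φ (𝒢.isotropy.r a) : ℂ) * f a, (Complex.continuous_ofReal.comp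
    (φ.continuous.comp 𝒢.isotropy.continuous_r)).mul f.continuous⟩, f.hasCompactSupport.mul_left⟩

namespace DualIsotropy

theorem continuous_char (p : DualIsotropy β) : Continuous fun a => (p.char a : ℂ) :=
  continuous_induced_dom.comp (map_continuous p.char)

theorem continuous_eval (f : CompactlySupportedContinuousMap 𝒢.IsotropyBundle ℂ) :
    Continuous fun p : DualIsotropy β => p.eval f :=
  have h : Continuous (eval : DualIsotropy β → _) := continuous_induced_dom
  (continuous_apply f).comp h

theorem eval_mulBase (p : DualIsotropy β) (φ : C(X, ℝ))
    (f : CompactlySupportedContinuousMap 𝒢.IsotropyBundle ℂ) :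
    p.eval (mulBase φ f) = φ p.base * p.eval f := by
  rw [eval, eval, ← integral_const_mul]
  refine integral_congr_ae (Filter.Eventually.of_forall fun a => ?_)
  change (p.char a : ℂ) * ((φ (𝒢.isotropy.r a.toBundle) : ℂ) * f a.toBundle) = _
  rw [a.r_toBundle]
  ring

theorem exists_eval_ne_zero (p : DualIsotropy β) :
    ∃ f : CompactlySupportedContinuousMap 𝒢.IsotropyBundle ℂ, p.eval f ≠ 0 :=
  β.exists_integral_mul_ne_zero p.continuous_char (a₀ := 1) (by simp)

/-- If `φ` is a bump at the base of `p` supported in `V`, then `q(φf) = φ(base q) q(f)`. Its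
nonvanishing is an open condition on `q` that forces the base of `q` into `V`. -/
theorem continuous_base : Continuous (base : DualIsotropy β → X) := by
  have := 𝒢.t2Space_units
  have := 𝒢.locallyCompactSpace_units
  refine continuous_iff_continuousAt.2 fun p => ?_
  intro V hV
  obtain ⟨f, hf⟩ := p.exists_eval_ne_zero
  obtain ⟨φ, h1, -, h0⟩ := CompactlySupportedContinuousMap.exists_bump hV
  have hne : p.eval (mulBase φ.toContinuousMap f) ≠ 0 := by
    rw [eval_mulBase]
    exact mul_ne_zero (by simp [h1]) hf
  have hev := (continuous_eval (mulBase φ.toContinuousMap f)).continuousAt.eventually_ne hne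
  change ∀ᶠ q : DualIsotropy β in 𝓝 p, q.base ∈ V
  filter_upwards [hev] with q hq
  by_contra hqV
  rw [eval_mulBase] at hq
  exact hq (by simp [h0 _ hqV])

/-- Functions on the units separate the bases, and test functions on a single group separate its
characters. It makes the dual Hausdorff, so compact sets there are closed. -/
theorem eval_injective : Function.Injective (eval : DualIsotropy β → _) := by
  have := 𝒢.t2Space_units
  have := 𝒢.locallyCompactSpace_units
  intro p q hpq
  have hb : p.base = q.base := by
    by_contra hne
    obtain ⟨f, hf⟩ := p.exists_eval_ne_zero
    obtain ⟨φ, h1, -, h0⟩ := CompactlySupportedContinuousMap.exists_bump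
      (isOpen_compl_singleton.mem_nhds hne : ({q.base}ᶜ : Set X) ∈ 𝓝 p.base)
    have h := congrFun hpq (mulBase φ.toContinuousMap f)
    rw [eval_mulBase, eval_mulBase, show φ.toContinuousMap p.base = 1 from h1,
      show φ.toContinuousMap q.base = 0 from h0 _ (by simp)] at h
    exact hf (by simpa using h)
  obtain ⟨u, χ⟩ := p
  obtain ⟨v, ψ⟩ := q
  obtain rfl : u = v := hb
  congr 1
  refine PontryaginDual.ext fun a => ?_
  by_contra hne
  let p : DualIsotropy β := ⟨u, χ⟩
  let q : DualIsotropy β := ⟨u, ψ⟩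
  obtain ⟨f, hf⟩ := β.exists_integral_mul_ne_zero (p.continuous_char.sub q.continuous_char)
    (a₀ := a) (sub_ne_zero.2 fun h => hne (Circle.ext h))
  apply hf
  have hsub := integral_sub (β.integrable_mul p.continuous_char f)
    (β.integrable_mul q.continuous_char f)
  refine ((integral_congr_ae (Filter.Eventually.of_forall fun a => ?_)).trans hsub).trans
    (sub_eq_zero.2 (congrFun hpq f))
  exact sub_mul _ _ _

instance : T2Space (DualIsotropy β) :=
  T2Space.of_injective_continuous eval_injective continuous_induced_dom

variable (β) in
/-- The trivial character at a unit. -/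
noncomputable def trivial (u : X) : DualIsotropy β := ⟨u, 1⟩

theorem eval_trivial (u : X) (f : CompactlySupportedContinuousMap 𝒢.IsotropyBundle ℂ) :
    (trivial β u).eval f = ∫ a, f a ∂(β.measure u) := by
  rw [← β.integral_fiberMeasure]
  refine integral_congr_ae (Filter.Eventually.of_forall fun a => ?_)
  exact one_mul _

theorem continuous_trivial : Continuous (trivial β) := by
  refine continuous_induced_rng.2 (continuous_pi fun f => ?_)
  simp only [Function.comp_apply, eval_trivial]
  exact β.continuous_integral f

end DualIsotropy

end TopologicalGroupoid

/-! ### Conjugation and continuity of the action -/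

namespace TopologicalGroupoid

variable {G X : Type*} [TopologicalSpace G] [TopologicalSpace X] {𝒢 : TopologicalGroupoid G X}

/-- Conjugation `b ↦ γ⁻¹bγ` from `A_u` to `A_{s(γ)}`, where `u = r(γ)`. -/
def conjInv {u : X} (γ : G) (hu : 𝒢.r γ = u) (b : 𝒢.IsotropyGroup u) :
    𝒢.IsotropyGroup (𝒢.s γ) :=
  ⟨𝒢.mul (𝒢.mul (𝒢.inv γ) b.1 ((𝒢.s_inv γ).trans (hu.trans b.2.1.symm))) γ
      ((𝒢.s_mul _ _ _).trans (b.2.2.trans hu.symm)),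
    (𝒢.r_mul _ _ _).trans ((𝒢.r_mul _ _ _).trans (𝒢.r_inv γ)), 𝒢.s_mul _ _ _⟩

theorem mul_inv_mul_cancel (γ b : G) (h : 𝒢.s γ = 𝒢.s b) :
    𝒢.mul (𝒢.mul b (𝒢.inv γ) (h.symm.trans (𝒢.r_inv γ).symm)) γ
      ((𝒢.s_mul _ _ _).trans (𝒢.s_inv γ)) = b := by
  rw [𝒢.mul_assoc b (𝒢.inv γ) γ (h.symm.trans (𝒢.r_inv γ).symm) (𝒢.s_inv γ)]
  simp only [𝒢.inv_mul, 𝒢.mul_unit]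

theorem mul_mul_inv_cancel (γ b : G) (h : 𝒢.s b = 𝒢.r γ) :
    𝒢.mul (𝒢.mul b γ h) (𝒢.inv γ) ((𝒢.s_mul _ _ _).trans (𝒢.r_inv γ).symm) = b := by
  rw [𝒢.mul_assoc b γ (𝒢.inv γ) h (𝒢.r_inv γ).symm]
  simp only [𝒢.mul_inv, 𝒢.mul_unit]

theorem mul_inv_cancel_left (γ b : G) (h : 𝒢.r γ = 𝒢.r b) :
    𝒢.mul γ (𝒢.mul (𝒢.inv γ) b ((𝒢.s_inv γ).trans h))
      ((𝒢.r_inv γ).symm.trans (𝒢.r_mul _ _ _).symm) = b := by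
  rw [← 𝒢.mul_assoc γ (𝒢.inv γ) b (𝒢.r_inv γ).symm ((𝒢.s_inv γ).trans h)]
  simp only [𝒢.mul_inv, 𝒢.unit_mul]

theorem inv_mul_cancel_left (γ b : G) (h : 𝒢.s γ = 𝒢.r b) :
    𝒢.mul (𝒢.inv γ) (𝒢.mul γ b h) ((𝒢.s_inv γ).trans (𝒢.r_mul _ _ _).symm) = b := by
  rw [← 𝒢.mul_assoc (𝒢.inv γ) γ b (𝒢.s_inv γ) h]
  simp only [𝒢.inv_mul, 𝒢.unit_mul]

theorem conj_conjInv {u : X} (γ : G) (hu : 𝒢.r γ = u) (b : 𝒢.IsotropyGroup u) :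
    𝒢.conj γ hu (𝒢.conjInv γ hu b) = b := by
  apply Subtype.ext
  have h1 : 𝒢.s (𝒢.inv γ) = 𝒢.r b.1 := (𝒢.s_inv γ).trans (hu.trans b.2.1.symm)
  have h2 : 𝒢.s (𝒢.mul (𝒢.inv γ) b.1 h1) = 𝒢.r γ :=
    (𝒢.s_mul _ _ _).trans (b.2.2.trans hu.symm)
  change 𝒢.mul (𝒢.mul γ (𝒢.mul (𝒢.mul (𝒢.inv γ) b.1 h1) γ h2) _) (𝒢.inv γ) _ = b.1
  have e := 𝒢.mul_assoc γ (𝒢.mul (𝒢.inv γ) b.1 h1) γ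
    ((𝒢.r_inv γ).symm.trans (𝒢.r_mul _ _ _).symm) h2
  simp only [← e, mul_inv_cancel_left γ b.1 (hu.trans b.2.1.symm)]
  exact mul_mul_inv_cancel γ b.1 (b.2.2.trans hu.symm)

theorem conjInv_conj {u : X} (γ : G) (hu : 𝒢.r γ = u) (a : 𝒢.IsotropyGroup (𝒢.s γ)) :
    𝒢.conjInv γ hu (𝒢.conj γ hu a) = a := by
  apply Subtype.ext
  have h1 : 𝒢.s γ = 𝒢.r a.1 := a.2.1.symm
  have h2 : 𝒢.s (𝒢.mul γ a.1 h1) = 𝒢.r (𝒢.inv γ) :=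
    (𝒢.s_mul _ _ _).trans (a.2.2.trans (𝒢.r_inv γ).symm)
  change 𝒢.mul (𝒢.mul (𝒢.inv γ) (𝒢.mul (𝒢.mul γ a.1 h1) (𝒢.inv γ) h2) _) γ _ = a.1
  have e := 𝒢.mul_assoc (𝒢.inv γ) (𝒢.mul γ a.1 h1) (𝒢.inv γ)
    ((𝒢.s_inv γ).trans (𝒢.r_mul _ _ _).symm) h2
  simp only [← e, inv_mul_cancel_left γ a.1 h1]
  exact mul_inv_mul_cancel γ a.1 a.2.2.symm

theorem continuous_conjInv {u : X} : Continuous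
    fun p : {γ // 𝒢.r γ = u} × 𝒢.IsotropyGroup u => (𝒢.conjInv p.1.1 p.1.2 p.2).toBundle := by
  refine Continuous.subtype_mk ?_ _
  have h1 : Continuous fun p : {γ // 𝒢.r γ = u} × 𝒢.IsotropyGroup u => p.1.1 :=
    continuous_subtype_val.comp continuous_fst
  have h2 : Continuous fun p : {γ // 𝒢.r γ = u} × 𝒢.IsotropyGroup u => p.2.1 :=
    continuous_subtype_val.comp continuous_snd
  have h3 := 𝒢.continuous_mul.comp (Continuous.subtype_mk
    ((𝒢.continuous_inv.comp h1).prodMk h2)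
    (fun p => (𝒢.s_inv p.1.1).trans (p.1.2.trans p.2.2.1.symm)))
  exact 𝒢.continuous_mul.comp (Continuous.subtype_mk (h3.prodMk h1)
    (fun p => (𝒢.s_mul _ _ _).trans (p.2.2.2.trans p.1.2.symm)))

/-- Conjugation as an isomorphism of isotropy groups. -/
def conjEquiv {u : X} (γ : G) (hu : 𝒢.r γ = u) :
    𝒢.IsotropyGroup (𝒢.s γ) ≃ₜ* 𝒢.IsotropyGroup u where
  toFun := 𝒢.conj γ hu
  invFun := 𝒢.conjInv γ hu
  left_inv := conjInv_conj γ hu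
  right_inv := conj_conjInv γ hu
  map_mul' := map_mul (𝒢.conj γ hu)
  continuous_toFun := map_continuous (𝒢.conj γ hu)
  continuous_invFun := Continuous.subtype_mk (continuous_subtype_val.comp
    (continuous_conjInv.comp (continuous_const.prodMk continuous_id :
      Continuous fun b : 𝒢.IsotropyGroup u => ((⟨γ, hu⟩ : {γ // 𝒢.r γ = u}), b)))) _

/-- The arrows `γcγ⁻¹` with `γ` and `c` in compact sets form a compact set. -/
theorem exists_isCompact_conjInv [T2Space G] {u : X} {N : Set {γ // 𝒢.r γ = u}}
    (hN : IsCompact N) {K : Set 𝒢.IsotropyBundle} (hK : IsCompact K) :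
    ∃ k : Set (𝒢.IsotropyGroup u), IsCompact k ∧
      ∀ γ ∈ N, ∀ b, (𝒢.conjInv γ.1 γ.2 b).toBundle ∈ K → b ∈ k := by
  have := 𝒢.t2Space_units
  have hcl : IsClosed {p : {γ // 𝒢.r γ = u} × 𝒢.IsotropyBundle | 𝒢.s p.1.1 = 𝒢.r p.2.1} :=
    isClosed_eq (𝒢.continuous_s.comp (continuous_subtype_val.comp continuous_fst))
      (𝒢.continuous_r.comp (continuous_subtype_val.comp continuous_snd))
  let c : {p : {γ // 𝒢.r γ = u} × 𝒢.IsotropyBundle // 𝒢.s p.1.1 = 𝒢.r p.2.1} →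
      𝒢.IsotropyGroup u := fun p =>
    𝒢.conj p.1.1.1 p.1.1.2 ⟨p.1.2.1, p.2.symm, p.1.2.2.symm.trans p.2.symm⟩
  have hc : Continuous c := by
    refine Continuous.subtype_mk ?_ _
    have h1 : Continuous fun p : {p : {γ // 𝒢.r γ = u} × 𝒢.IsotropyBundle //
        𝒢.s p.1.1 = 𝒢.r p.2.1} => p.1.1.1 :=
      continuous_subtype_val.comp (continuous_fst.comp continuous_subtype_val)
    have h2 : Continuous fun p : {p : {γ // 𝒢.r γ = u} × 𝒢.IsotropyBundle //
        𝒢.s p.1.1 = 𝒢.r p.2.1} => p.1.2.1 :=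
      continuous_subtype_val.comp (continuous_snd.comp continuous_subtype_val)
    have h3 := 𝒢.continuous_mul.comp (Continuous.subtype_mk (h1.prodMk h2) (fun p => p.2))
    exact 𝒢.continuous_mul.comp (Continuous.subtype_mk (h3.prodMk (𝒢.continuous_inv.comp h1))
      (fun p => (𝒢.s_mul _ _ _).trans
        (p.1.2.2.symm.trans (p.2.symm.trans (𝒢.r_inv _).symm))))
  refine ⟨c '' (Subtype.val ⁻¹' (N ×ˢ K)),
    (hcl.isClosedEmbedding_subtypeVal.isCompact_preimage (hN.prod hK)).image hc,
    fun γ hγ b hb => ?_⟩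
  exact ⟨⟨(γ, (𝒢.conjInv γ.1 γ.2 b).toBundle), (𝒢.conjInv γ.1 γ.2 b).r_toBundle.symm⟩,
    ⟨hγ, hb⟩, conj_conjInv γ.1 γ.2 b⟩

variable [MeasurableSpace G] [BorelSpace G] [T2Space G] [LocallyCompactSpace G]
  [SecondCountableTopology G] {β : 𝒢.isotropy.HaarSystem}

/-- Transport of an integral over the isotropy group at `s(γ)` to the one at `r(γ)`. -/
theorem HaarSystem.exists_integral_conj_eq (β : 𝒢.isotropy.HaarSystem) {u : X}
    (γ : {γ // 𝒢.r γ = u}) : ∃ κ : ℂ, ∀ (h : 𝒢.IsotropyGroup u → ℂ) (f : 𝒢.IsotropyBundle → ℂ),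
      ∫ a, h (𝒢.conj γ.1 γ.2 a) * f a.toBundle ∂(β.fiberMeasure (𝒢.s γ.1)) =
        κ * ∫ b, h b * f (𝒢.conjInv γ.1 γ.2 b).toBundle ∂(β.fiberMeasure u) := by
  let e := 𝒢.conjEquiv γ.1 γ.2
  have : ((β.fiberMeasure (𝒢.s γ.1)).map e).IsHaarMeasure :=
    e.isHaarMeasure_map _
  have he : MeasurableEmbedding e := e.toHomeomorph.measurableEmbedding
  -- Conjugation carries one Haar measure to a multiple of the other. That the factor is the same
  -- for all `h` and `f` is what allows its continuity to be tested on the trivial character.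
  refine ⟨((Measure.haarScalarFactor ((β.fiberMeasure (𝒢.s γ.1)).map e) (β.fiberMeasure u) : ℝ) :
    ℂ), fun h f => ?_⟩
  rw [← Complex.real_smul, ← NNReal.smul_def, ← integral_smul_nnreal_measure,
    ← Measure.isMulLeftInvariant_eq_smul, he.integral_map]
  refine integral_congr_ae (Filter.Eventually.of_forall fun a => ?_)
  change _ = h (𝒢.conj γ.1 γ.2 a) * f (𝒢.conjInv γ.1 γ.2 (𝒢.conj γ.1 γ.2 a)).toBundle
  rw [conjInv_conj]

/-- After transport, the group and the measure are fixed and only the integrand moves with `γ`;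
locally in `γ` its supports lie in one compact set. -/
theorem HaarSystem.continuous_integral_conjInv (β : 𝒢.isotropy.HaarSystem) {u : X}
    {h : 𝒢.IsotropyGroup u → ℂ} (hc : Continuous h)
    (f : CompactlySupportedContinuousMap 𝒢.IsotropyBundle ℂ) :
    Continuous fun γ : {γ // 𝒢.r γ = u} =>
      ∫ b, h b * f (𝒢.conjInv γ.1 γ.2 b).toBundle ∂(β.fiberMeasure u) := by
  have := 𝒢.t2Space_units
  have : LocallyCompactSpace {γ // 𝒢.r γ = u} :=
    (isClosed_singleton.preimage 𝒢.continuous_r :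
      IsClosed (𝒢.r ⁻¹' {u})).isClosedEmbedding_subtypeVal.locallyCompactSpace
  refine continuous_iff_continuousAt.2 fun γ₀ => ?_
  obtain ⟨N, hN, hN₀⟩ := exists_compact_mem_nhds γ₀
  obtain ⟨k, hk, hkN⟩ := exists_isCompact_conjInv hN f.hasCompactSupport.isCompact
  refine (continuousOn_integral_of_compact_support (s := N) hk ?_ ?_).continuousAt hN₀
  · refine Continuous.continuousOn ?_
    exact (hc.comp continuous_snd).mul (f.continuous.comp continuous_conjInv)
  · intro γ b hγ hb
    rw [image_eq_zero_of_notMem_tsupport fun h => hb (hkN γ hγ b h), mul_zero]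

/-- The action on a fixed point of the dual is continuous. -/
theorem DualIsotropy.continuous_act (p : DualIsotropy β) :
    Continuous fun γ : {γ // 𝒢.r γ = p.base} => p.act γ.1 γ.2 := by
  refine continuous_induced_rng.2 (continuous_pi fun f => ?_)
  choose κ hκ using fun γ : {γ // 𝒢.r γ = p.base} => β.exists_integral_conj_eq γ
  have hκp : ∀ γ, (p.act γ.1 γ.2).eval f =
      κ γ * ∫ b, (p.char b : ℂ) * f (𝒢.conjInv γ.1 γ.2 b).toBundle ∂(β.fiberMeasure p.base) :=
    fun γ => hκ γ (fun b => (p.char b : ℂ)) f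
  refine continuous_iff_continuousAt.2 fun γ₀ => ?_
  -- Continuity of `κ` is read off the trivial character: `(1, s(γ))(f₀) = κ(γ) J(γ)`, where the
  -- left side and `J` are continuous and `J(γ₀) ≠ 0`, so `κ` is a continuous quotient near `γ₀`.
  obtain ⟨f₀, hf₀⟩ := (trivial β (𝒢.s γ₀.1)).exists_eval_ne_zero
  set J : {γ // 𝒢.r γ = p.base} → ℂ := fun γ =>
    ∫ b, 1 * f₀ (𝒢.conjInv γ.1 γ.2 b).toBundle ∂(β.fiberMeasure p.base) with hJdef
  have hκ₀ : ∀ γ : {γ // 𝒢.r γ = p.base}, (trivial β (𝒢.s γ.1)).eval f₀ = κ γ * J γ :=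
    fun γ => hκ γ (fun _ => 1) f₀
  have hJ : Continuous J := β.continuous_integral_conjInv continuous_const f₀
  have hL : Continuous fun γ : {γ // 𝒢.r γ = p.base} => (trivial β (𝒢.s γ.1)).eval f₀ :=
    (continuous_eval f₀).comp (continuous_trivial.comp
      (𝒢.continuous_s.comp continuous_subtype_val))
  have hJ₀ : J γ₀ ≠ 0 := by
    intro h0
    rw [hκ₀, h0, mul_zero] at hf₀
    exact hf₀ rfl
  refine ((hL.continuousAt.div hJ.continuousAt hJ₀).mul
    (β.continuous_integral_conjInv p.continuous_char f).continuousAt).congr ?_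
  filter_upwards [hJ.continuousAt.eventually_ne hJ₀] with γ hγ
  refine Eq.trans ?_ (hκp γ).symm
  refine congrArg (fun z : ℂ => z * _) ?_
  change (trivial β (𝒢.s γ.1)).eval f₀ / J γ = κ γ
  rw [hκ₀, mul_div_cancel_right₀ _ hγ]

end TopologicalGroupoid

/-! ### Closed orbits -/

theorem t1Space_quotient_iff {Y : Type*} [TopologicalSpace Y] (S : Setoid Y) :
    T1Space (Quotient S) ↔ ∀ x, IsClosed {y | S x y} := by
  have h : ∀ x, Quotient.mk S ⁻¹' {Quotient.mk S x} = {y | S x y} := fun x => by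
    ext y
    exact Quotient.eq.trans ⟨S.symm, S.symm⟩
  constructor
  · intro _ x
    rw [← h]
    exact isClosed_singleton.preimage continuous_quotient_mk'
  · refine fun H => ⟨fun q => ?_⟩
    induction q using Quotient.inductionOn with
    | h x =>
      rw [← isQuotientMap_quotient_mk'.isClosed_preimage]
      exact (h x).symm ▸ H x

namespace TopologicalGroupoid

variable {G X : Type*} [TopologicalSpace G] [TopologicalSpace X] {𝒢 : TopologicalGroupoid G X}

/-- If an orbit is closed, then locally its points are the sources of arrows from a compact set of
arrows with a fixed range. -/
theorem exists_isCompact_source [T2Space G] [LocallyCompactSpace G] [SecondCountableTopology G]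
    (hr : IsOpenMap 𝒢.r) {u : X} (hu : IsClosed {v | 𝒢.orbitSetoid u v}) {v : X}
    (hv : 𝒢.orbitSetoid u v) :
    ∃ V ∈ 𝓝 v, ∃ K : Set {γ // 𝒢.r γ = u}, IsCompact K ∧
      ∀ w ∈ V, 𝒢.orbitSetoid u w → ∃ κ ∈ K, 𝒢.s κ.1 = w := by
  have := 𝒢.t2Space_units
  have := 𝒢.locallyCompactSpace_units
  have : LocallyCompactSpace {v | 𝒢.orbitSetoid u v} :=
    hu.isClosedEmbedding_subtypeVal.locallyCompactSpace
  have hY : IsClosedEmbedding (Subtype.val : {γ // 𝒢.r γ = u} → G) :=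
    (isClosed_singleton.preimage 𝒢.continuous_r :
      IsClosed (𝒢.r ⁻¹' {u})).isClosedEmbedding_subtypeVal
  have : LocallyCompactSpace {γ // 𝒢.r γ = u} := hY.locallyCompactSpace
  have : SecondCountableTopology {γ // 𝒢.r γ = u} := hY.isEmbedding.secondCountableTopology
  have : Nonempty {v | 𝒢.orbitSetoid u v} := ⟨⟨v, hv⟩⟩
  let σ : {γ // 𝒢.r γ = u} → {v | 𝒢.orbitSetoid u v} := fun γ => ⟨𝒢.s γ.1, γ.1, γ.2, rfl⟩
  have hσ : Continuous σ := (𝒢.continuous_s.comp continuous_subtype_val).subtype_mk _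
  -- Baire category: the closed orbit is a countable union of compact images, so one of them has an
  -- interior point `w`.
  obtain ⟨n, w, hw⟩ := nonempty_interior_of_iUnion_of_closed
    (f := fun n => σ '' compactCovering {γ // 𝒢.r γ = u} n)
    (fun n => ((isCompact_compactCovering _ n).image hσ).isClosed) (by
      rw [← Set.image_iUnion, iUnion_compactCovering, Set.image_univ, Set.range_eq_univ]
      rintro ⟨w, γ, hγ, rfl⟩
      exact ⟨⟨γ, hγ⟩, rfl⟩)
  have hw' := mem_interior_iff_mem_nhds.1 hw
  rw [nhds_subtype_eq_comap, Filter.mem_comap] at hw'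
  obtain ⟨W, hW, hWn⟩ := hw'
  -- An arrow `η` from `w` to `v` moves the interior point to `v`. Units near `v` are ranges of
  -- arrows `ζ` near `η`; if `κ` in the compact piece has the same source as `ζ`, then `κζ⁻¹` has
  -- range `u` and source `r(ζ)`.
  obtain ⟨η, hηr, hηs⟩ := 𝒢.orbitSetoid.trans (𝒢.orbitSetoid.symm hv) w.2
  have hηW : 𝒢.s ⁻¹' W ∈ 𝓝 η := 𝒢.continuous_s.continuousAt.preimage_mem_nhds (by rwa [hηs])
  obtain ⟨M, hM, hMW, hMc⟩ := local_compact_nhds hηW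
  have hV := hr.image_mem_nhds hM
  rw [hηr] at hV
  have hcl : IsClosed {p : {γ // 𝒢.r γ = u} × G | 𝒢.s p.1.1 = 𝒢.s p.2} :=
    isClosed_eq (𝒢.continuous_s.comp (continuous_subtype_val.comp continuous_fst))
      (𝒢.continuous_s.comp continuous_snd)
  let c : {p : {γ // 𝒢.r γ = u} × G // 𝒢.s p.1.1 = 𝒢.s p.2} → {γ // 𝒢.r γ = u} := fun p =>
    ⟨𝒢.mul p.1.1.1 (𝒢.inv p.1.2) (p.2.trans (𝒢.r_inv _).symm), (𝒢.r_mul _ _ _).trans p.1.1.2⟩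
  have hc : Continuous c := by
    refine Continuous.subtype_mk ?_ _
    exact 𝒢.continuous_mul.comp (Continuous.subtype_mk
      ((continuous_subtype_val.comp (continuous_fst.comp continuous_subtype_val)).prodMk
        (𝒢.continuous_inv.comp (continuous_snd.comp continuous_subtype_val)))
      (fun p => p.2.trans (𝒢.r_inv _).symm))
  refine ⟨𝒢.r '' M, hV, c '' (Subtype.val ⁻¹' (compactCovering _ n ×ˢ M)),
    (hcl.isClosedEmbedding_subtypeVal.isCompact_preimage
      ((isCompact_compactCovering _ n).prod hMc)).image hc, ?_⟩
  rintro _ ⟨ζ, hζ, rfl⟩ hζu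
  have hs : 𝒢.orbitSetoid u (𝒢.s ζ) := 𝒢.orbitSetoid.trans hζu ⟨ζ, rfl, rfl⟩
  obtain ⟨κ, hκ, hκζ⟩ := hWn (show (⟨𝒢.s ζ, hs⟩ : {v | 𝒢.orbitSetoid u v}) ∈ _ from hMW hζ)
  exact ⟨_, ⟨⟨(κ, ζ), congrArg Subtype.val hκζ⟩, ⟨hκ, hζ⟩, rfl⟩,
    (𝒢.s_mul _ _ _).trans (𝒢.s_inv ζ)⟩

variable [MeasurableSpace G] {β : 𝒢.isotropy.HaarSystem}

namespace DualIsotropy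

theorem orbitSetoid_iff (hab : 𝒢.AbelianIsotropy) (p q : DualIsotropy β) :
    orbitSetoid hab β p q ↔ ∃ (γ : G) (h : 𝒢.r γ = p.base), p.act γ h = q := by
  constructor
  · rintro ⟨ρ, h, hq⟩
    induction ρ using Quotient.inductionOn with
    | h γ => exact ⟨γ, h, hq⟩
  · rintro ⟨γ, h, hq⟩
    exact ⟨Quotient.mk _ γ, h, hq⟩

/-- Arrows with the same range and source act in the same way. -/
theorem act_eq_act (hab : 𝒢.AbelianIsotropy) (p : DualIsotropy β) {γ η : G}
    (hγ : 𝒢.r γ = p.base) (hη : 𝒢.r η = p.base) (hs : 𝒢.s γ = 𝒢.s η) :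
    p.act γ hγ = p.act η hη := by
  have h : 𝒢.s (𝒢.inv γ) = 𝒢.r η := (𝒢.s_inv γ).trans (hγ.trans hη.symm)
  refine act_congr hab p ⟨⟨𝒢.mul (𝒢.inv γ) η h, ?_⟩, ?_, ?_⟩ hγ hη
  · rw [𝒢.r_mul, 𝒢.s_mul, 𝒢.r_inv, hs]
  · rw [𝒢.r_mul, 𝒢.r_inv]
  · exact mul_inv_cancel_left γ η (hγ.trans hη.symm)

variable [BorelSpace G] [T2Space G] [LocallyCompactSpace G] [SecondCountableTopology G]

/-- The base of a limit point `q` lies in the closed orbit of units. Orbit points near `q` are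
reached by some arrow, which may be replaced by one in a compact set `K` with the same source, so
`q` lies in the closed image of `K`. -/
theorem isClosed_orbit (hab : 𝒢.AbelianIsotropy) (hr : IsOpenMap 𝒢.r) (p : DualIsotropy β)
    (hp : IsClosed {v | 𝒢.orbitSetoid p.base v}) : IsClosed {q | orbitSetoid hab β p q} := by
  refine isClosed_of_closure_subset fun q hq => ?_
  have hsub : {q | orbitSetoid hab β p q} ⊆ base ⁻¹' {v | 𝒢.orbitSetoid p.base v} := by
    intro q hq
    obtain ⟨γ, h, rfl⟩ := (orbitSetoid_iff hab p q).1 hq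
    exact ⟨γ, h, rfl⟩
  have hqv : 𝒢.orbitSetoid p.base q.base :=
    closure_minimal hsub (hp.preimage continuous_base) hq
  obtain ⟨V, hV, K, hK, hVK⟩ := exists_isCompact_source hr hp hqv
  have hΦ := hK.image p.continuous_act
  have hmem : q ∈ closure ((fun γ : {γ // 𝒢.r γ = p.base} => p.act γ.1 γ.2) '' K) := by
    rw [mem_closure_iff_nhds] at hq ⊢
    intro U hU
    obtain ⟨q', ⟨hq'U, hq'V⟩, hq'⟩ :=
      hq _ (Filter.inter_mem hU (continuous_base.continuousAt.preimage_mem_nhds hV))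
    refine ⟨q', hq'U, ?_⟩
    obtain ⟨κ, hκ, hκs⟩ := hVK _ hq'V (hsub hq')
    obtain ⟨γ, h, rfl⟩ := (orbitSetoid_iff hab p q').1 hq'
    exact ⟨κ, hκ, act_eq_act hab p κ.2 h hκs⟩
  rw [hΦ.isClosed.closure_eq] at hmem
  obtain ⟨κ, -, rfl⟩ := hmem
  exact (orbitSetoid_iff hab p _).2 ⟨κ.1, κ.2, rfl⟩

theorem orbitSetoid_trivial_iff (hab : 𝒢.AbelianIsotropy) (u v : X) :
    orbitSetoid hab β (trivial β u) (trivial β v) ↔ 𝒢.orbitSetoid u v := by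
  rw [orbitSetoid_iff]
  constructor
  · rintro ⟨γ, h, hq⟩
    exact ⟨γ, h, congrArg base hq⟩
  · rintro ⟨γ, rfl, rfl⟩
    exact ⟨γ, rfl, rfl⟩

end DualIsotropy

end TopologicalGroupoid

theorem mainTheorem11 {G X : Type*} [TopologicalSpace G] [TopologicalSpace X]
    [SecondCountableTopology G] [LocallyCompactSpace G] [T2Space G]
    [MeasurableSpace G] [BorelSpace G]
    (𝒢 : TopologicalGroupoid G X)
    (haar : Nonempty 𝒢.HaarSystem)
    (abelian : 𝒢.AbelianIsotropy)
    (varying : 𝒢.ContinuouslyVaryingIsotropy) :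
    Nonempty 𝒢.isotropy.HaarSystem ∧
      ∀ β : 𝒢.isotropy.HaarSystem,
        T1Space 𝒢.OrbitSpace ↔
          T1Space (TopologicalGroupoid.DualIsotropy.OrbitSpace abelian β) := by
  refine ⟨TopologicalGroupoid.nonempty_isotropy_haarSystem varying, fun β => ?_⟩
  obtain ⟨l⟩ := haar
  rw [t1Space_quotient_iff, t1Space_quotient_iff]
  constructor
  · exact fun H p => TopologicalGroupoid.DualIsotropy.isClosed_orbit abelian l.isOpenMap_r p
      (H p.base)
  · intro H u
    -- The orbit of `u` is the preimage of the orbit of `(1, u)` under the continuous section of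
    -- trivial characters.
    have h := (H (TopologicalGroupoid.DualIsotropy.trivial β u)).preimage
      TopologicalGroupoid.DualIsotropy.continuous_trivial
    convert h using 1
    ext v
    exact (TopologicalGroupoid.DualIsotropy.orbitSetoid_trivial_iff abelian u v).symm
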